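/- Let $\alpha,\beta,\lambda>0$. Write $\mathrm{Ga}(a,b)$ for the Gamma law with shape $a$ and rate $b$ (with $\mathrm{Ga}(0,b)=\delta_0$) and $\mathrm{Be}(a,b)$ for the Beta law. Let $\mathcal G$ be a gamma random measure on $\mathbb R^2$: a countably additive random Borel measure that assigns independent random variables $\mathcal G(A_i)\sim\mathrm{Ga}(\alpha|A_i|,\beta)$ to disjoint Borel sets $A_i$ of finite area $|A_i|$. For $t\in\mathbb R$ set $$G_t=\{(x,y):\ 0\le y<\lambda e^{-2\lambda|t-x|}\},\qquad X_t=\mathcal G(G_t).$$ For $0<\rho<1$, a thinned gamma process with parameters $(\alpha,\beta,\rho)$ is a process $(Y_n)_{n\in\mathbb Z}$ with $Y_0\sim\mathrm{Ga}(\alpha,\beta)$, $Y_n=B_nY_{n-1}+\zeta_n$ for $n>0$ and $Y_n=B_nY_{n+1}+\zeta_n$ for $n<0$, where $B_n\sim\mathrm{Be}(\alpha\rho,\alpha(1-\rho))$, $\zeta_n\sim\mathrm{Ga}(\alpha(1-\rho),\beta)$, and $Y_0$, all the $B_n$ and all the $\zeta_n$ are mutually independent. Then: 1. $(X_t)_{t\in\mathbb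 R}$ is strictly stationary, $X_t\sim\mathrm{Ga}(\alpha,\beta)$ for every $t$ (so $X_t$ is square integrable), and $\mathrm{Corr}(X_s,X_t)=e^{-\lambda|s-t|}$ for all $s,t\in\mathbb R$. 2. For all $s,t\in\mathbb R$, with $r=e^{-\lambda|s-t|}$, and all $a,b\in\mathbb R$, $$\mathsf E\,e^{iaX_s+ibX_t}=(1-ia/\beta)^{-\alpha(1-r)}\,(1-i(a+b)/\beta)^{-\alpha r}\,(1-ib/\beta)^{-\alpha(1-r)}.$$ 3. For all $s\ne t$, if $Y$ is any thinned gamma process with parameters $(\alpha,\beta,e^{-\lambda|s-t|})$, then $(X_s,X_t)$ has the same law as $(Y_n,Y_{n+1})$ for every $n\in\mathbb Z$. In particular, the laws at two consecutive integer times coincide with those of the thinned process with $\rho=e^{-\lambda}$. 4. If $Y$ is a thinned gamma process with parameters $(\alpha,\beta,e^{-\lambda})$, then for all $s\in\mathbb R$ and $n\in\mathbb Z$ the laws of the consecutive triplets $(X_s,X_{s+1},X_{s+2})$ and $(Y_n,Y_{n+1},Y_{n+2})$ are different. 5. $(X_t)_{t\in\mathbb R}$ is not a Markov process with respect to its own history;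 neither is $(X_n)_{n\in\mathbb Z}$. 6. For all $k$ and $t_1,\dots,t_k\in\mathbb R$ the law of $(X_{t_1},\dots,X_{t_k})$ is infinitely divisible: for every $n\ge1$ it is the law of a sum of $n$ i.i.d. random vectors. -/

import Mathlib

open MeasureTheory ProbabilityTheory

/-- The Gamma law `Ga(a, b)` with shape `a ≥ 0` and rate `b > 0`, with the usual convention that
`Ga(0, b)` is the unit mass at `0`. -/
noncomputable def gammaLaw (a b : ℝ) : Measure ℝ :=
  if a = 0 then Measure.dirac 0 else gammaMeasure a b

/-- `G` is a gamma random measure on the plane with `G(A) ∼ Ga(α |A|, β)`: a random (countably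
additive) Borel measure that assigns independent random variables with these laws to disjoint Borel
sets of finite area. The law of `G(A)` is stated on `[0, ∞]`, so that `G(A) < ∞` almost surely is
part of it. -/
structure IsGammaRandomMeasure {Ω : Type*} [MeasurableSpace Ω] (α β : ℝ)
    (G : Ω → Measure (ℝ × ℝ)) (P : Measure Ω) : Prop where
  measurable : Measurable G
  law : ∀ A : Set (ℝ × ℝ), MeasurableSet A → volume A ≠ ⊤ →
    P.map (fun ω => G ω A) = (gammaLaw (α * (volume A).toReal) β).map ENNReal.ofReal
  indep : ∀ (n : ℕ) (A : Fin n → Set (ℝ × ℝ)), (∀ i, MeasurableSet (A i)) →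
    (∀ i, volume (A i) ≠ ⊤) → Pairwise (fun i j => Disjoint (A i) (A j)) →
    iIndepFun (fun i ω => G ω (A i)) P

/-- The set `G_t = {(x, y) : 0 ≤ y < λ exp(-2 λ |t - x|)}`. -/
def gammaRegion (lam t : ℝ) : Set (ℝ × ℝ) :=
  {p | 0 ≤ p.2 ∧ p.2 < lam * Real.exp (-2 * lam * |t - p.1|)}

/-- The random measure gamma process `X_t = G(G_t)`. -/
noncomputable def randomMeasureProcess {Ω : Type*} (G : Ω → Measure (ℝ × ℝ)) (lam : ℝ) :
    ℝ → Ω → ℝ :=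
  fun t ω => (G ω (gammaRegion lam t)).toReal

/-- `Y` is a thinned gamma process with parameters `α, β, ρ`: it starts at `Y 0 ∼ Ga(α, β)`, and
away from time `0`, in both directions, each value is a beta fraction `B t` of its neighbour nearer
to `0` plus an innovation `ζ t`, where `B t ∼ Be(αρ, α(1-ρ))` and `ζ t ∼ Ga(α(1-ρ), β)`, and where
`Y 0`, all the `B t` and all the `ζ t` are mutually independent. -/
def IsThinnedGammaProcess {Ω : Type*} [MeasurableSpace Ω] (α β ρ : ℝ)
    (Y : ℤ → Ω → ℝ) (P : Measure Ω) : Prop :=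
  ∃ B ζ : {t : ℤ // t ≠ 0} → Ω → ℝ,
    Measurable (Y 0) ∧ (∀ t, Measurable (B t)) ∧ (∀ t, Measurable (ζ t)) ∧
    P.map (Y 0) = gammaMeasure α β ∧
    (∀ t, P.map (B t) = betaMeasure (α * ρ) (α * (1 - ρ))) ∧
    (∀ t, P.map (ζ t) = gammaMeasure (α * (1 - ρ)) β) ∧
    iIndepFun (fun i : Option ({t : ℤ // t ≠ 0} ⊕ {t : ℤ // t ≠ 0}) =>
      i.elim (Y 0) (Sum.elim B ζ)) P ∧
    (∀ t : {t : ℤ // t ≠ 0}, 0 < (t : ℤ) → ∀ ω, Y t ω = B t ω * Y (t - 1) ω + ζ t ω) ∧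
    (∀ t : {t : ℤ // t ≠ 0}, (t : ℤ) < 0 → ∀ ω, Y t ω = B t ω * Y (t + 1) ω + ζ t ω)

/-- Strict stationarity: all finite-dimensional laws are invariant under time shifts. -/
def IsStationaryProcess {Ω : Type*} [MeasurableSpace Ω] (X : ℝ → Ω → ℝ) (P : Measure Ω) : Prop :=
  ∀ (n : ℕ) (t : Fin n → ℝ) (h : ℝ),
    P.map (fun ω (i : Fin n) => X (t i + h) ω) = P.map (fun ω (i : Fin n) => X (t i) ω)

/-- The correlation coefficient of two (square integrable, nondegenerate) random variables. -/
noncomputable def correlation {Ω : Type*} [MeasurableSpace Ω] (X Y : Ω → ℝ) (P : Measure Ω) : ℝ :=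
  covariance X Y P / (√(variance X P) * √(variance Y P))

/-- The Markov property of a process of random variables with respect to its own history:
`P(X t ∈ A | X u, u ≤ s) = P(X t ∈ A | X s)` almost surely for all `s ≤ t` and Borel `A`. -/
def IsMarkovProcess {T Ω : Type*} [Preorder T] [MeasurableSpace Ω]
    (X : T → Ω → ℝ) (P : Measure Ω) : Prop :=
  ∀ s t : T, s ≤ t → ∀ A : Set ℝ, MeasurableSet A →
    condExp (⨆ (u : T) (_ : u ≤ s), MeasurableSpace.comap (X u) (borel ℝ)) P
        ((X t ⁻¹' A).indicator fun _ => (1 : ℝ))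
      =ᵐ[P] condExp (MeasurableSpace.comap (X s) (borel ℝ)) P
        ((X t ⁻¹' A).indicator fun _ => (1 : ℝ))

/-- A law `Q` is infinitely divisible: for every `n ≥ 1` it is the law of a sum of `n` independent
and identically distributed random vectors. -/
def IsInfinitelyDivisibleLaw {k : ℕ} (Q : Measure (Fin k → ℝ)) : Prop :=
  ∀ n : ℕ, 1 ≤ n → ∃ ν : Measure (Fin k → ℝ), IsProbabilityMeasure ν ∧
    (Measure.pi fun _ : Fin n => ν).map (fun z => ∑ j, z j) = Q

/-!
Everything is read off from the masses that `G` gives to the pieces into which the regions `G_t`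
cut the plane. These masses are independent gamma variables whose shapes are `α` times the areas
of the pieces.

**Joint laws of `X`.** For finitely many times, the values of `X` are a fixed linear image of the
masses of the Venn diagram atoms of the regions (`IsGammaRandomMeasure.map_family`), so the joint
law depends only on the areas of the atoms. A time shift translates the atoms, which gives
stationarity; dividing all shapes by `n` gives infinite divisibility. For two times, `|G_s ∩ G_t|
= exp (-λ |s - t|)` because `max |s - x| |t - x|` is `|s - t| / 2` plus the distance of `x` from
the midpoint (`volume_inter_gammaRegion`). Hence `(X_s, X_t) = (U + V, V + W)` with independent
gamma variables, and the characteristic function of the gamma law (`charFun_gammaMeasure`) gives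
the joint one.

**Thinning.** Beta–gamma algebra (`map_gamma_prod_beta`) splits a gamma variable `Y` into
independent parts `B Y` and `(1 - B) Y`; therefore `(Y, B Y + ζ)` has the law of `(U + V, V + W)`
too (`thinPair_eq_map_add`). That law is symmetric, so it does not matter on which side of time
`0` the thinned process is observed.

**Triplets and the Markov property.** If `X` were Markov, or if its triplets had the laws of the
thinned process, then `(X_0, X_2)` would arise from `(X_0, X_1)` by one thinning step with `ρ =
e^{-λ}` (`IsMarkovProcess.map_skip`, `IsThinnedGammaProcess.map_succ`). But its law is that of a
single thinning step with parameter `ρ²`. The moments `E[X_0² X_2²]` of these two candidates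
differ by a nonzero multiple of `ρ² (1 - ρ)²` (`thinStep_thinPair_ne`). Their covariances
agree, so moments beyond the second order are needed.
-/

/-! ### Gamma and beta laws -/

/-- Multiplication by `x` raises the shape of a gamma density by one; all moments follow. -/
theorem gammaPDF_mul_self {a r : ℝ} (ha : 0 < a) (hr : 0 < r) (x : ℝ) :
    gammaPDFReal a r x * x = a / r * gammaPDFReal (a + 1) r x := by
  unfold gammaPDFReal
  split_ifs with hx
  · rcases hx.eq_or_lt with rfl | hx
    · have : (0 : ℝ) ^ (a + 1 - 1) = 0 := by
        rw [add_sub_cancel_right, Real.zero_rpow ha.ne']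
      rw [this]; simp
    · rw [Real.Gamma_add_one ha.ne', Real.rpow_add_one hr.ne', add_sub_cancel_right]
      have h : x ^ a = x ^ (a - 1) * x := by
        rw [← Real.rpow_add_one hx.ne', sub_add_cancel]
      have := (Real.Gamma_pos_of_pos ha).ne'
      rw [h]
      field_simp
  · simp

theorem integral_gammaMeasure_eq {a r : ℝ} (ha : 0 < a) (hr : 0 < r) {E : Type*}
    [NormedAddCommGroup E] [NormedSpace ℝ E] (f : ℝ → E) :
    ∫ x, f x ∂gammaMeasure a r = ∫ x, gammaPDFReal a r x • f x := by
  rw [gammaMeasure, integral_withDensity_eq_integral_toReal_smul (by unfold gammaPDF; fun_prop)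
    (by simp [gammaPDF])]
  simp [gammaPDF, ENNReal.toReal_ofReal (gammaPDFReal_nonneg ha hr _)]

theorem integrable_gammaMeasure_iff {a r : ℝ} (ha : 0 < a) (hr : 0 < r) (f : ℝ → ℝ) :
    Integrable f (gammaMeasure a r) ↔ Integrable (fun x => gammaPDFReal a r x * f x) := by
  rw [gammaMeasure, integrable_withDensity_iff_integrable_smul' (by unfold gammaPDF; fun_prop)
    (by simp [gammaPDF])]
  simp [gammaPDF, ENNReal.toReal_ofReal (gammaPDFReal_nonneg ha hr _)]

theorem integrable_mul_gammaMeasure {a r : ℝ} (ha : 0 < a) (hr : 0 < r) {f : ℝ → ℝ}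
    (hf : Integrable f (gammaMeasure (a + 1) r)) :
    Integrable (fun x => x * f x) (gammaMeasure a r) := by
  rw [integrable_gammaMeasure_iff ha hr]
  rw [integrable_gammaMeasure_iff (by linarith) hr] at hf
  simpa only [← mul_assoc, gammaPDF_mul_self ha hr] using hf.const_mul (a / r)

theorem integral_mul_gammaMeasure {a r : ℝ} (ha : 0 < a) (hr : 0 < r) (f : ℝ → ℝ) :
    ∫ x, x * f x ∂gammaMeasure a r = a / r * ∫ x, f x ∂gammaMeasure (a + 1) r := by
  rw [integral_gammaMeasure_eq ha hr, integral_gammaMeasure_eq (by linarith) hr]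
  simp only [smul_eq_mul, ← mul_assoc, gammaPDF_mul_self ha hr]
  simp only [mul_assoc, integral_const_mul]

theorem integrable_pow_gammaMeasure {r : ℝ} (hr : 0 < r) (n : ℕ) :
    ∀ {a : ℝ}, 0 < a → Integrable (fun x => x ^ n) (gammaMeasure a r) := by
  induction n with
  | zero =>
    intro a ha
    have := isProbabilityMeasure_gammaMeasure ha hr
    simp
  | succ n ih =>
    intro a ha
    simpa only [pow_succ'] using integrable_mul_gammaMeasure ha hr (ih (by linarith))

theorem integral_pow_gammaMeasure {r : ℝ} (hr : 0 < r) (n : ℕ) :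
    ∀ {a : ℝ}, 0 < a →
      ∫ x, x ^ n ∂gammaMeasure a r = ∏ i ∈ Finset.range n, (a + i) / r := by
  induction n with
  | zero =>
    intro a ha
    have := isProbabilityMeasure_gammaMeasure ha hr
    simp
  | succ n ih =>
    intro a ha
    simp only [pow_succ', integral_mul_gammaMeasure ha hr, ih (a := a + 1) (by linarith),
      Finset.prod_range_succ' _ n]
    rw [mul_comm]
    congr 1
    · refine Finset.prod_congr rfl fun i _ => ?_
      push_cast; ring
    · simp

/-- Multiplication by `x` raises the first parameter of a beta density by one; all moments
follow. -/
theorem betaPDF_mul_self {a b : ℝ} (ha : 0 < a) (hb : 0 < b) (x : ℝ) :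
    betaPDFReal a b x * x = a / (a + b) * betaPDFReal (a + 1) b x := by
  unfold betaPDFReal
  split_ifs with hx
  · have h : x ^ a = x ^ (a - 1) * x := by
      rw [← Real.rpow_add_one hx.1.ne', sub_add_cancel]
    have h1 := (Real.Gamma_pos_of_pos ha).ne'
    have h2 := (Real.Gamma_pos_of_pos hb).ne'
    have h3 := (Real.Gamma_pos_of_pos (add_pos ha hb)).ne'
    rw [beta, beta, add_sub_cancel_right, Real.Gamma_add_one ha.ne', h, add_right_comm,
      Real.Gamma_add_one (by positivity)]
    field_simp
  · simp

theorem betaPDFReal_nonneg {a b : ℝ} (ha : 0 < a) (hb : 0 < b) (x : ℝ) :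
    0 ≤ betaPDFReal a b x := by
  by_cases hx : 0 < x ∧ x < 1
  · exact (betaPDFReal_pos hx.1 hx.2 ha hb).le
  · simp [betaPDFReal, hx]

theorem integral_betaMeasure_eq {a b : ℝ} (ha : 0 < a) (hb : 0 < b) (f : ℝ → ℝ) :
    ∫ x, f x ∂betaMeasure a b = ∫ x, betaPDFReal a b x * f x := by
  rw [betaMeasure, integral_withDensity_eq_integral_toReal_smul (by unfold betaPDF; fun_prop)
    (by simp [betaPDF])]
  simp [betaPDF, ENNReal.toReal_ofReal (betaPDFReal_nonneg ha hb _)]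

theorem integrable_betaMeasure_iff {a b : ℝ} (ha : 0 < a) (hb : 0 < b) (f : ℝ → ℝ) :
    Integrable f (betaMeasure a b) ↔ Integrable (fun x => betaPDFReal a b x * f x) := by
  rw [betaMeasure, integrable_withDensity_iff_integrable_smul' (by unfold betaPDF; fun_prop)
    (by simp [betaPDF])]
  simp [betaPDF, ENNReal.toReal_ofReal (betaPDFReal_nonneg ha hb _)]

theorem integrable_pow_betaMeasure {b : ℝ} (hb : 0 < b) (n : ℕ) :
    ∀ {a : ℝ}, 0 < a → Integrable (fun x => x ^ n) (betaMeasure a b) := by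
  induction n with
  | zero =>
    intro a ha
    have := isProbabilityMeasureBeta ha hb
    simp
  | succ n ih =>
    intro a ha
    have h := ih (a := a + 1) (by linarith)
    rw [integrable_betaMeasure_iff (by linarith) hb] at h
    rw [integrable_betaMeasure_iff ha hb]
    simpa only [pow_succ', ← mul_assoc, betaPDF_mul_self ha hb] using h.const_mul (a / (a + b))

theorem integral_pow_betaMeasure {b : ℝ} (hb : 0 < b) (n : ℕ) :
    ∀ {a : ℝ}, 0 < a →
      ∫ x, x ^ n ∂betaMeasure a b = ∏ i ∈ Finset.range n, (a + i) / (a + b + i) := by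
  induction n with
  | zero =>
    intro a ha
    have := isProbabilityMeasureBeta ha hb
    simp
  | succ n ih =>
    intro a ha
    have h := ih (a := a + 1) (by linarith)
    rw [integral_betaMeasure_eq (by linarith) hb] at h
    rw [integral_betaMeasure_eq ha hb]
    simp only [pow_succ', ← mul_assoc, betaPDF_mul_self ha hb]
    simp only [mul_assoc, integral_const_mul]
    rw [h, Finset.prod_range_succ' _ n, mul_comm]
    congr 1
    · refine Finset.prod_congr rfl fun i _ => ?_
      push_cast; ring
    · simp

/-- Exponential tilting changes the rate of a gamma density. -/
theorem gammaPDFReal_mul_exp {a r t : ℝ} (hr : 0 < r) (ht : t < r) (x : ℝ) :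
    gammaPDFReal a r x * Real.exp (t * x) = (r / (r - t)) ^ a * gammaPDFReal a (r - t) x := by
  have h : 0 < r - t := by linarith
  unfold gammaPDFReal
  split_ifs
  · have e : Real.exp (-(r * x)) * Real.exp (t * x) = Real.exp (-((r - t) * x)) := by
      rw [← Real.exp_add]; congr 1; ring
    rw [mul_assoc, e, Real.div_rpow hr.le h.le]
    have := (Real.rpow_pos_of_pos h a).ne'
    field_simp
  · simp

theorem integrable_exp_gammaMeasure {a r t : ℝ} (ha : 0 < a) (hr : 0 < r) (ht : t < r) :
    Integrable (fun x => Real.exp (t * x)) (gammaMeasure a r) := by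
  have h : 0 < r - t := by linarith
  have := isProbabilityMeasure_gammaMeasure ha h
  rw [integrable_gammaMeasure_iff ha hr]
  simp only [gammaPDFReal_mul_exp hr ht]
  have h1 := (integrable_gammaMeasure_iff ha h fun _ => 1).1 (integrable_const 1)
  simpa using h1.const_mul _

theorem mgf_gammaMeasure {a r t : ℝ} (ha : 0 < a) (hr : 0 < r) (ht : t < r) :
    mgf id (gammaMeasure a r) t = (1 - t / r) ^ (-a) := by
  have h : 0 < r - t := by linarith
  have := isProbabilityMeasure_gammaMeasure ha h
  rw [mgf, integral_gammaMeasure_eq ha hr]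
  simp only [smul_eq_mul, id, gammaPDFReal_mul_exp hr ht, integral_const_mul]
  have h1 := integral_gammaMeasure_eq ha h fun _ => (1 : ℝ)
  have e : 1 - t / r = (r / (r - t))⁻¹ := by field_simp
  rw [e, Real.inv_rpow (by positivity), Real.rpow_neg (by positivity), inv_inv]
  simpa using congrArg (fun c => (r / (r - t)) ^ a * c) h1.symm

/-- The characteristic function of the gamma law. It is the analytic continuation to the imaginary
axis of the moment generating function, which is explicit by exponential tilting. -/
theorem charFun_gammaMeasure {a r : ℝ} (ha : 0 < a) (hr : 0 < r) (t : ℝ) :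
    charFun (gammaMeasure a r) t = (1 - Complex.I * t / r) ^ (-a : ℂ) := by
  let U : Set ℂ := {z | z.re < r}
  have hU : IsOpen U := isOpen_lt Complex.continuous_re continuous_const
  have hint : Set.Iio r ⊆ interior (integrableExpSet id (gammaMeasure a r)) :=
    interior_maximal (fun _ ht => integrable_exp_gammaMeasure ha hr ht) isOpen_Iio
  have hf : AnalyticOnNhd ℂ (complexMGF id (gammaMeasure a r)) U :=
    analyticOnNhd_complexMGF.mono fun z hz => hint hz
  have hslit : ∀ z ∈ U, 1 - z / r ∈ Complex.slitPlane := by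
    intro z hz
    refine Or.inl ?_
    have h1 : (1 - z / r).re = 1 - z.re / r := by simp [Complex.div_ofReal_re]
    rw [h1, sub_pos, div_lt_one hr]
    exact hz
  have hg : AnalyticOnNhd ℂ (fun z : ℂ => (1 - z / r) ^ (-a : ℂ)) U := by
    refine DifferentiableOn.analyticOnNhd (fun z hz => ?_) hU
    have h1 : DifferentiableAt ℂ (fun z : ℂ => 1 - z / r) z :=
      (differentiableAt_const _).sub (differentiableAt_id.div_const _)
    exact (h1.cpow (differentiableAt_const _) (hslit z hz)).differentiableWithinAt
  have hconv : IsPreconnected U := (convex_halfSpace_re_lt r).isPreconnected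
  have h0 : (0 : ℂ) ∈ U := by simpa [U] using hr
  have hreal : ∀ᶠ x : ℝ in nhdsWithin 0 {0}ᶜ,
      complexMGF id (gammaMeasure a r) x = (1 - (x : ℂ) / r) ^ (-a : ℂ) := by
    refine Filter.Eventually.filter_mono nhdsWithin_le_nhds ?_
    filter_upwards [Iio_mem_nhds hr] with x hx
    have hx : x < r := hx
    have : 0 ≤ 1 - x / r := by rw [sub_nonneg, div_le_one hr]; exact hx.le
    rw [complexMGF_ofReal, mgf_gammaMeasure ha hr hx, Complex.ofReal_cpow this]
    push_cast; rfl
  have htend : Filter.Tendsto (fun x : ℝ => (x : ℂ)) (nhdsWithin 0 {0}ᶜ) (nhdsWithin 0 {0}ᶜ) := by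
    refine tendsto_nhdsWithin_iff.2 ⟨?_, ?_⟩
    · have := Complex.continuous_ofReal.tendsto 0
      simp only [Complex.ofReal_zero] at this
      exact this.mono_left nhdsWithin_le_nhds
    · filter_upwards [self_mem_nhdsWithin] with x hx
      simpa using hx
  have heq := hf.eqOn_of_preconnected_of_frequently_eq hg hconv h0
    (htend.frequently hreal.frequently)
  rw [← complexMGF_id_mul_I, heq (show (t * Complex.I : ℂ) ∈ U by simpa [U] using hr)]
  simp only [mul_comm Complex.I]

theorem lintegral_comp_mul_right_eq {y : ℝ} (hy : y ≠ 0) {g : ℝ → ENNReal} (hg : Measurable g) :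
    ∫⁻ t, g (t * y) = ENNReal.ofReal |y⁻¹| * ∫⁻ u, g u := by
  rw [← lintegral_map hg (by fun_prop), Real.map_volume_mul_right hy, lintegral_smul_measure,
    smul_eq_mul]

/-- The density identity behind beta–gamma algebra: with `u` the selected part of `y`, the joint
density of `(u, y)` is that of independent parts `u` and `y - u`. The factor `|y⁻¹|` is the Jacobian
of the substitution `u = t * y`. -/
theorem gammaPDF_mul_betaPDF {a b r : ℝ} (ha : 0 < a) (hb : 0 < b) (hr : 0 < r) {u y : ℝ}
    (hu : u ≠ 0) (hy : y ≠ 0) (hyu : y ≠ u) :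
    gammaPDF (a + b) r y * (ENNReal.ofReal |y⁻¹| * betaPDF a b (u / y)) =
      gammaPDF a r u * gammaPDF b r (y - u) := by
  have h1 := gammaPDFReal_nonneg (add_pos ha hb) hr y
  have h2 := gammaPDFReal_nonneg ha hr u
  rw [gammaPDF, betaPDF, gammaPDF, gammaPDF, ← ENNReal.ofReal_mul (abs_nonneg _),
    ← ENNReal.ofReal_mul h1, ← ENNReal.ofReal_mul h2]
  congr 1
  rcases lt_or_gt_of_ne hy with hy | hy
  · rw [gammaPDFReal, if_neg (not_le.2 hy), zero_mul]
    rcases lt_or_ge u 0 with hu | hu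
    · simp [gammaPDFReal, not_le.2 hu]
    · simp [gammaPDFReal, show ¬ u ≤ y by linarith]
  by_cases h : 0 < u ∧ u < y
  · have hv : 0 < y - u := by linarith [h.2]
    rw [gammaPDFReal, gammaPDFReal, gammaPDFReal, betaPDFReal, if_pos hy.le, if_pos h.1.le,
      if_pos hv.le, if_pos ⟨div_pos h.1 hy, (div_lt_one hy).2 h.2⟩, abs_of_pos (inv_pos.2 hy), beta]
    have h1 := (Real.Gamma_pos_of_pos ha).ne'
    have h2 := (Real.Gamma_pos_of_pos hb).ne'
    have h3 := (Real.Gamma_pos_of_pos (add_pos ha hb)).ne'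
    have e1 : 1 - u / y = (y - u) / y := by field_simp
    have e2 : y ^ (a + b - 1) = y ^ (a - 1) * y ^ (b - 1) * y := by
      rw [← Real.rpow_add hy, ← Real.rpow_add_one hy.ne']; congr 1; ring
    have e3 : Real.exp (-(r * y)) = Real.exp (-(r * u)) * Real.exp (-(r * (y - u))) := by
      rw [← Real.exp_add]; congr 1; ring
    have p1 := (Real.rpow_pos_of_pos hy (a - 1)).ne'
    have p2 := (Real.rpow_pos_of_pos hy (b - 1)).ne'
    rw [e1, Real.div_rpow h.1.le hy.le, Real.div_rpow hv.le hy.le, e2, e3, Real.rpow_add hr]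
    field_simp
  · have hb0 : betaPDFReal a b (u / y) = 0 := by
      rw [betaPDFReal, if_neg]
      rintro ⟨h1, h2⟩
      exact h ⟨by rwa [div_pos_iff_of_pos_right hy] at h1, (div_lt_one hy).1 h2⟩
    rw [hb0, mul_zero, mul_zero]
    rcases lt_or_gt_of_ne hu with hu | hu
    · simp [gammaPDFReal, not_le.2 hu]
    · have : ¬ u ≤ y := fun h' => h ⟨hu, lt_of_le_of_ne h' (Ne.symm hyu)⟩
      simp [gammaPDFReal, this]

/-- Beta–gamma algebra: a `Be(a, b)` fraction of a `Ga(a + b, r)` variable and the complementary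
fraction are independent, with laws `Ga(a, r)` and `Ga(b, r)`. -/
theorem map_gamma_prod_beta {a b r : ℝ} (ha : 0 < a) (hb : 0 < b) (hr : 0 < r) :
    ((gammaMeasure (a + b) r).prod (betaMeasure a b)).map
        (fun p => (p.2 * p.1, p.1 - p.2 * p.1)) =
      (gammaMeasure a r).prod (gammaMeasure b r) := by
  have i1 := isProbabilityMeasure_gammaMeasure (add_pos ha hb) hr
  have i2 := isProbabilityMeasure_gammaMeasure ha hr
  have i3 := isProbabilityMeasure_gammaMeasure hb hr
  have i4 := isProbabilityMeasureBeta ha hb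
  have mg : ∀ c, Measurable (gammaPDF c r) := fun c => by unfold gammaPDF; fun_prop
  have mb : Measurable (betaPDF a b) := by unfold betaPDF; fun_prop
  refine Measure.ext_of_lintegral _ fun f hf => ?_
  rw [lintegral_map hf (by fun_prop), lintegral_prod _ (by fun_prop),
    lintegral_prod _ (by fun_prop)]
  unfold gammaMeasure betaMeasure at *
  have hL : ∀ y : ℝ, y ≠ 0 → ∫⁻ t, f (t * y, y - t * y) ∂volume.withDensity (betaPDF a b) =
      ENNReal.ofReal |y⁻¹| * ∫⁻ u, betaPDF a b (u / y) * f (u, y - u) := by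
    intro y hy
    rw [lintegral_withDensity_eq_lintegral_mul _ mb (by fun_prop),
      ← lintegral_comp_mul_right_eq hy (by fun_prop)]
    refine lintegral_congr fun t => ?_
    simp [mul_div_assoc, div_self hy]
  rw [lintegral_withDensity_eq_lintegral_mul _ (mg _) (by fun_prop),
    lintegral_withDensity_eq_lintegral_mul _ (mg _) (by fun_prop)]
  have hL' : ∫⁻ y, (gammaPDF (a + b) r * fun y => ∫⁻ t, f (t * y, y - t * y)
      ∂volume.withDensity (betaPDF a b)) y =
      ∫⁻ y, ∫⁻ u, gammaPDF (a + b) r y * (ENNReal.ofReal |y⁻¹| * betaPDF a b (u / y)) *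
        f (u, y - u) := by
    refine lintegral_congr_ae ?_
    filter_upwards [Measure.ae_ne volume (0 : ℝ)] with y hy
    simp only [Pi.mul_apply]
    rw [hL y hy, ← lintegral_const_mul _ (by fun_prop), ← lintegral_const_mul _ (by fun_prop)]
    simp only [mul_assoc]
  rw [hL', lintegral_lintegral_swap (by fun_prop)]
  refine lintegral_congr_ae ?_
  filter_upwards [Measure.ae_ne volume (0 : ℝ)] with u hu
  simp only [Pi.mul_apply]
  rw [lintegral_withDensity_eq_lintegral_mul _ (mg _) (by fun_prop),
    ← lintegral_const_mul _ (by fun_prop)]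
  refine (lintegral_congr_ae ?_).trans (lintegral_sub_right_eq_self _ u)
  filter_upwards [Measure.ae_ne volume (0 : ℝ), Measure.ae_ne volume u] with y hy hyu
  rw [gammaPDF_mul_betaPDF ha hb hr hu hy hyu]
  simp [mul_assoc]

theorem isProbabilityMeasure_gammaLaw {a b : ℝ} (ha : 0 ≤ a) (hb : 0 < b) :
    IsProbabilityMeasure (gammaLaw a b) := by
  unfold gammaLaw
  split_ifs with h
  · infer_instance
  · exact isProbabilityMeasure_gammaMeasure (lt_of_le_of_ne ha (Ne.symm h)) hb

theorem gammaLaw_of_pos {a b : ℝ} (ha : 0 < a) : gammaLaw a b = gammaMeasure a b :=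
  if_neg ha.ne'

theorem ae_nonneg_gammaLaw (a b : ℝ) : ∀ᵐ x ∂gammaLaw a b, 0 ≤ x := by
  unfold gammaLaw
  split_ifs
  · simp
  · rw [gammaMeasure, ae_withDensity_iff (by unfold gammaPDF; fun_prop)]
    refine Filter.Eventually.of_forall fun x hx => ?_
    by_contra h
    exact hx (gammaPDF_of_neg (not_le.1 h))

theorem charFun_gammaLaw {a b : ℝ} (ha : 0 ≤ a) (hb : 0 < b) (t : ℝ) :
    charFun (gammaLaw a b) t = (1 - Complex.I * t / b) ^ (-a : ℂ) := by
  rcases ha.eq_or_lt with rfl | ha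
  · simp [gammaLaw]
  · rw [gammaLaw_of_pos ha, charFun_gammaMeasure ha hb]

/-! ### One step of beta thinning -/

/-- The joint law of the independent coefficients `(B, ζ)` of a thinning step:
`B ∼ Be(αρ, α(1-ρ))` and `ζ ∼ Ga(α(1-ρ), β)`. -/
noncomputable def thinningLaw (α β ρ : ℝ) : Measure (ℝ × ℝ) :=
  (betaMeasure (α * ρ) (α * (1 - ρ))).prod (gammaMeasure (α * (1 - ρ)) β)

/-- The law of `(x, B * y + ζ)` when `(x, y) ∼ μ` is independent of the coefficients `(B, ζ)`:
the second coordinate makes one step of the thinned gamma chain. -/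
noncomputable def thinStep (α β ρ : ℝ) (μ : Measure (ℝ × ℝ)) : Measure (ℝ × ℝ) :=
  (μ.prod (thinningLaw α β ρ)).map fun p => (p.1.1, p.2.1 * p.1.2 + p.2.2)

/-- The law of two consecutive values of the stationary thinned gamma chain. -/
noncomputable def thinPair (α β ρ : ℝ) : Measure (ℝ × ℝ) :=
  thinStep α β ρ ((gammaMeasure α β).map fun x => (x, x))

section
variable {α β ρ : ℝ} (hα : 0 < α) (hβ : 0 < β) (hρ : 0 < ρ) (hρ1 : ρ < 1)
include hα hβ hρ hρ1

theorem isProbabilityMeasure_thinningLaw : IsProbabilityMeasure (thinningLaw α β ρ) := by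
  have h1 : 0 < α * (1 - ρ) := mul_pos hα (by linarith)
  have := isProbabilityMeasure_gammaMeasure h1 hβ
  have := isProbabilityMeasureBeta (mul_pos hα hρ) h1
  unfold thinningLaw
  infer_instance

theorem isProbabilityMeasure_thinStep (μ : Measure (ℝ × ℝ)) [IsProbabilityMeasure μ] :
    IsProbabilityMeasure (thinStep α β ρ μ) := by
  have := isProbabilityMeasure_thinningLaw hα hβ hρ hρ1
  exact Measure.isProbabilityMeasure_map (by fun_prop)

theorem isProbabilityMeasure_thinPair : IsProbabilityMeasure (thinPair α β ρ) := by
  have := isProbabilityMeasure_gammaMeasure hα hβ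
  have : IsProbabilityMeasure ((gammaMeasure α β).map fun x => (x, x)) :=
    Measure.isProbabilityMeasure_map (by fun_prop)
  exact isProbabilityMeasure_thinStep hα hβ hρ hρ1 _

theorem map_fst_thinStep (μ : Measure (ℝ × ℝ)) [IsProbabilityMeasure μ] :
    (thinStep α β ρ μ).map Prod.fst = μ.map Prod.fst := by
  have := isProbabilityMeasure_thinningLaw hα hβ hρ hρ1
  rw [thinStep, Measure.map_map (by fun_prop) (by fun_prop)]
  have : (Prod.fst ∘ fun p : (ℝ × ℝ) × ℝ × ℝ => (p.1.1, p.2.1 * p.1.2 + p.2.2)) =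
      Prod.fst ∘ Prod.fst := rfl
  rw [this, ← Measure.map_map (by fun_prop) (by fun_prop), Measure.map_fst_prod]
  simp

theorem map_fst_thinPair : (thinPair α β ρ).map Prod.fst = gammaMeasure α β := by
  have := isProbabilityMeasure_gammaMeasure hα hβ
  have : IsProbabilityMeasure ((gammaMeasure α β).map fun x => (x, x)) :=
    Measure.isProbabilityMeasure_map (by fun_prop)
  rw [thinPair, map_fst_thinStep hα hβ hρ hρ1, Measure.map_map (by fun_prop) (by fun_prop)]
  exact Measure.map_id

/-- By beta–gamma algebra, the pair law of the thinned chain is that of `(U + V, V + W)` with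
independent gamma variables `U`, `V`, `W`, of which `V` is the common part. -/
theorem thinPair_eq_map_add : thinPair α β ρ =
    (((gammaMeasure (α * (1 - ρ)) β).prod (gammaMeasure (α * ρ) β)).prod
      (gammaMeasure (α * (1 - ρ)) β)).map fun p => (p.1.1 + p.1.2, p.1.2 + p.2) := by
  have h1 : 0 < α * (1 - ρ) := mul_pos hα (by linarith)
  have i1 := isProbabilityMeasure_gammaMeasure h1 hβ
  have i2 := isProbabilityMeasure_gammaMeasure (mul_pos hα hρ) hβ
  have i3 := isProbabilityMeasure_gammaMeasure hα hβ
  have i4 := isProbabilityMeasureBeta (mul_pos hα hρ) h1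
  have key := map_gamma_prod_beta (mul_pos hα hρ) h1 hβ
  rw [show α * ρ + α * (1 - ρ) = α by ring] at key
  rw [← Measure.prod_swap (μ := gammaMeasure (α * ρ) β) (ν := gammaMeasure (α * (1 - ρ)) β), ← key,
    Measure.map_map (by fun_prop) (by fun_prop)]
  have e : ∀ ν : Measure ℝ, ν = ν.map id := fun ν => Measure.map_id.symm
  conv_rhs => rw [e (gammaMeasure (α * (1 - ρ)) β)]
  rw [Measure.map_prod_map _ _ (by fun_prop) (by fun_prop),
    Measure.map_map (by fun_prop) (by fun_prop), thinPair, thinStep]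
  have e' : thinningLaw α β ρ = (thinningLaw α β ρ).map id := Measure.map_id.symm
  have := isProbabilityMeasure_thinningLaw hα hβ hρ hρ1
  rw [e', Measure.map_prod_map _ _ (by fun_prop) (by fun_prop),
    Measure.map_map (by fun_prop) (by fun_prop), thinningLaw, ← Measure.prodAssoc_prod,
    Measure.map_map (by fun_prop) (by fun_prop)]
  congr 1
  funext p
  simp [MeasurableEquiv.prodAssoc]

theorem map_swap_thinPair : (thinPair α β ρ).map Prod.swap = thinPair α β ρ := by
  have h1 : 0 < α * (1 - ρ) := mul_pos hα (by linarith)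
  have i1 := isProbabilityMeasure_gammaMeasure h1 hβ
  have i2 := isProbabilityMeasure_gammaMeasure (mul_pos hα hρ) hβ
  rw [thinPair_eq_map_add hα hβ hρ hρ1]
  set μ := gammaMeasure (α * (1 - ρ)) β
  set ν := gammaMeasure (α * ρ) β
  have h : MeasurePreserving (fun p : (ℝ × ℝ) × ℝ => ((p.2, p.1.2), p.1.1))
      ((μ.prod ν).prod μ) ((μ.prod ν).prod μ) := by
    have a1 : MeasurePreserving Prod.swap ((μ.prod ν).prod μ) (μ.prod (μ.prod ν)) :=
      Measure.measurePreserving_swap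
    have a2 : MeasurePreserving (Prod.map id Prod.swap) (μ.prod (μ.prod ν)) (μ.prod (ν.prod μ)) :=
      (MeasurePreserving.id μ).prod Measure.measurePreserving_swap
    have a3 : MeasurePreserving (MeasurableEquiv.prodAssoc.symm) (μ.prod (ν.prod μ))
        ((μ.prod ν).prod μ) := (measurePreserving_prodAssoc μ ν μ).symm
    exact a3.comp (a2.comp a1)
  conv_rhs => rw [← h.map_eq]
  rw [Measure.map_map (by fun_prop) (by fun_prop), Measure.map_map (by fun_prop) (by fun_prop)]
  congr 1
  funext p
  simp [add_comm]

theorem map_snd_thinPair : (thinPair α β ρ).map Prod.snd = gammaMeasure α β := by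
  rw [← map_swap_thinPair hα hβ hρ hρ1, Measure.map_map (by fun_prop) (by fun_prop)]
  exact map_fst_thinPair hα hβ hρ hρ1

end

/-- `thinStep` for random variables. -/
theorem map_eq_thinStep {Ω : Type*} [MeasurableSpace Ω] {P : Measure Ω} [IsProbabilityMeasure P]
    {α β ρ : ℝ} {Z : Ω → ℝ × ℝ} {B ζ : Ω → ℝ} (hZ : Measurable Z) (hB : Measurable B)
    (hζ : Measurable ζ) (lB : P.map B = betaMeasure (α * ρ) (α * (1 - ρ)))
    (lζ : P.map ζ = gammaMeasure (α * (1 - ρ)) β) (hBζ : IndepFun B ζ P)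
    (hind : IndepFun Z (fun ω => (B ω, ζ ω)) P) :
    P.map (fun ω => ((Z ω).1, B ω * (Z ω).2 + ζ ω)) = thinStep α β ρ (P.map Z) := by
  have h1 := (indepFun_iff_map_prod_eq_prod_map_map hB.aemeasurable hζ.aemeasurable).1 hBζ
  have h2 := (indepFun_iff_map_prod_eq_prod_map_map hZ.aemeasurable (by fun_prop)).1 hind
  rw [thinStep, thinningLaw, ← lB, ← lζ, ← h1, ← h2, Measure.map_map (by fun_prop) (by fun_prop)]
  rfl

/-! ### Mixed moments -/

section
variable {α β ρ : ℝ} (hα : 0 < α) (hβ : 0 < β) (hρ : 0 < ρ) (hρ1 : ρ < 1)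
include hα hβ hρ hρ1

theorem integrable_thinningLaw (i j : ℕ) :
    Integrable (fun p : ℝ × ℝ => p.1 ^ i * p.2 ^ j) (thinningLaw α β ρ) := by
  have h1 : 0 < α * (1 - ρ) := mul_pos hα (by linarith)
  have i1 := isProbabilityMeasure_gammaMeasure h1 hβ
  have i4 := isProbabilityMeasureBeta (mul_pos hα hρ) h1
  exact (integrable_pow_betaMeasure h1 i (mul_pos hα hρ)).mul_prod
    (integrable_pow_gammaMeasure hβ j h1)

theorem integral_thinningLaw (i j : ℕ) :
    ∫ p, p.1 ^ i * p.2 ^ j ∂thinningLaw α β ρ =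
      (∏ m ∈ Finset.range i, (α * ρ + m) / (α + m)) *
        ∏ m ∈ Finset.range j, (α * (1 - ρ) + m) / β := by
  have h1 : 0 < α * (1 - ρ) := mul_pos hα (by linarith)
  have i1 := isProbabilityMeasure_gammaMeasure h1 hβ
  have i4 := isProbabilityMeasureBeta (mul_pos hα hρ) h1
  rw [thinningLaw, integral_prod_mul (fun x : ℝ => x ^ i) (fun x : ℝ => x ^ j),
    integral_pow_betaMeasure h1 i (mul_pos hα hρ), integral_pow_gammaMeasure hβ j h1]
  congr 1
  refine Finset.prod_congr rfl fun m _ => ?_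
  congr 1; ring

theorem integrable_mixed_thinStep {μ : Measure (ℝ × ℝ)} [IsProbabilityMeasure μ]
    (hμ : ∀ k j : ℕ, Integrable (fun p : ℝ × ℝ => p.1 ^ k * p.2 ^ j) μ) (k j : ℕ) :
    Integrable (fun p : ℝ × ℝ => p.1 ^ k * p.2 ^ j) (thinStep α β ρ μ) := by
  have := isProbabilityMeasure_thinningLaw hα hβ hρ hρ1
  rw [thinStep, integrable_map_measure (by fun_prop) (by fun_prop)]
  have : ((fun p : ℝ × ℝ => p.1 ^ k * p.2 ^ j) ∘
      fun p : (ℝ × ℝ) × ℝ × ℝ => (p.1.1, p.2.1 * p.1.2 + p.2.2)) = fun p =>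
      ∑ m ∈ Finset.range (j + 1), (p.1.1 ^ k * p.1.2 ^ m) * (p.2.1 ^ m * p.2.2 ^ (j - m)) *
        (j.choose m : ℝ) := by
    funext p
    simp only [Function.comp, add_pow, Finset.mul_sum]
    refine Finset.sum_congr rfl fun m _ => ?_
    ring
  rw [this]
  refine integrable_finsetSum _ fun m _ => Integrable.mul_const ?_ _
  exact (hμ k m).mul_prod (integrable_thinningLaw hα hβ hρ hρ1 m (j - m))

/-- Mixed moments after a thinning step, by the binomial expansion of `(B * y + ζ) ^ j`. -/
theorem integral_mixed_thinStep {μ : Measure (ℝ × ℝ)} [IsProbabilityMeasure μ]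
    (hμ : ∀ k j : ℕ, Integrable (fun p : ℝ × ℝ => p.1 ^ k * p.2 ^ j) μ) (k j : ℕ) :
    ∫ p, p.1 ^ k * p.2 ^ j ∂thinStep α β ρ μ = ∑ m ∈ Finset.range (j + 1),
      (∫ p, p.1 ^ k * p.2 ^ m ∂μ) *
        ((∏ l ∈ Finset.range m, (α * ρ + l) / (α + l)) *
          ∏ l ∈ Finset.range (j - m), (α * (1 - ρ) + l) / β) * (j.choose m : ℝ) := by
  have := isProbabilityMeasure_thinningLaw hα hβ hρ hρ1
  rw [thinStep, integral_map (by fun_prop) (by fun_prop)]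
  have : (fun p : (ℝ × ℝ) × ℝ × ℝ => p.1.1 ^ k * (p.2.1 * p.1.2 + p.2.2) ^ j) = fun p =>
      ∑ m ∈ Finset.range (j + 1), (p.1.1 ^ k * p.1.2 ^ m) * (p.2.1 ^ m * p.2.2 ^ (j - m)) *
        (j.choose m : ℝ) := by
    funext p
    simp only [add_pow, Finset.mul_sum]
    refine Finset.sum_congr rfl fun m _ => ?_
    ring
  rw [this, integral_finsetSum]
  · refine Finset.sum_congr rfl fun m _ => ?_
    rw [integral_mul_const, ← integral_thinningLaw hα hβ hρ hρ1]
    congr 1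
    exact integral_prod_mul (fun p : ℝ × ℝ => p.1 ^ k * p.2 ^ m)
      (fun p : ℝ × ℝ => p.1 ^ m * p.2 ^ (j - m))
  · intro m _
    exact ((hμ k m).mul_prod (integrable_thinningLaw hα hβ hρ hρ1 m (j - m))).mul_const _

omit hρ hρ1 in
theorem integrable_mixed_diag (k j : ℕ) :
    Integrable (fun p : ℝ × ℝ => p.1 ^ k * p.2 ^ j) ((gammaMeasure α β).map fun x => (x, x)) := by
  rw [integrable_map_measure (by fun_prop) (by fun_prop)]
  simpa [Function.comp_def, pow_add] using integrable_pow_gammaMeasure hβ (k + j) hα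

omit hρ hρ1 in
theorem integral_mixed_diag (k j : ℕ) :
    ∫ p, p.1 ^ k * p.2 ^ j ∂((gammaMeasure α β).map fun x => (x, x)) =
      ∏ i ∈ Finset.range (k + j), (α + i) / β := by
  rw [integral_map (by fun_prop) (by fun_prop), ← integral_pow_gammaMeasure hβ _ hα]
  simp [pow_add]

theorem integrable_mixed_thinPair (k j : ℕ) :
    Integrable (fun p : ℝ × ℝ => p.1 ^ k * p.2 ^ j) (thinPair α β ρ) := by
  have := isProbabilityMeasure_gammaMeasure hα hβ
  have : IsProbabilityMeasure ((gammaMeasure α β).map fun x => (x, x)) :=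
    Measure.isProbabilityMeasure_map (by fun_prop)
  exact integrable_mixed_thinStep hα hβ hρ hρ1 (integrable_mixed_diag hα hβ) k j

theorem integral_mixed_thinPair (k j : ℕ) :
    ∫ p, p.1 ^ k * p.2 ^ j ∂thinPair α β ρ = ∑ m ∈ Finset.range (j + 1),
      (∏ i ∈ Finset.range (k + m), (α + i) / β) *
        ((∏ l ∈ Finset.range m, (α * ρ + l) / (α + l)) *
          ∏ l ∈ Finset.range (j - m), (α * (1 - ρ) + l) / β) * (j.choose m : ℝ) := by
  have := isProbabilityMeasure_gammaMeasure hα hβ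
  have : IsProbabilityMeasure ((gammaMeasure α β).map fun x => (x, x)) :=
    Measure.isProbabilityMeasure_map (by fun_prop)
  rw [thinPair, integral_mixed_thinStep hα hβ hρ hρ1 (integrable_mixed_diag hα hβ)]
  simp only [integral_mixed_diag hα hβ]

/-- Two thinning steps with parameter `ρ` are not one thinning step with parameter `ρ ^ 2`: the
moments `E[x² y²]` differ. -/
theorem thinStep_thinPair_ne : thinStep α β ρ (thinPair α β ρ) ≠ thinPair α β (ρ ^ 2) := by
  intro h
  have hq : 0 < ρ ^ 2 := by positivity
  have hq1 : ρ ^ 2 < 1 := by nlinarith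
  have := isProbabilityMeasure_thinPair hα hβ hρ hρ1
  have h2 : ∫ p, p.1 ^ 2 * p.2 ^ 2 ∂thinStep α β ρ (thinPair α β ρ) =
      ∫ p, p.1 ^ 2 * p.2 ^ 2 ∂thinPair α β (ρ ^ 2) := by rw [h]
  rw [integral_mixed_thinStep hα hβ hρ hρ1 (integrable_mixed_thinPair hα hβ hρ hρ1),
    integral_mixed_thinPair hα hβ hq hq1] at h2
  simp only [integral_mixed_thinPair hα hβ hρ hρ1] at h2
  simp [Finset.sum_range_succ, Finset.prod_range_succ] at h2
  have a0 := hα.ne'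
  have a1 : α + 1 ≠ 0 := by positivity
  have b0 := hβ.ne'
  field_simp at h2
  -- the difference of the two moments, up to a positive factor
  have h3 : -2 * α * ρ ^ 2 * (1 - ρ) ^ 2 = 0 := by linear_combination h2
  have h4 : 1 - ρ ≠ 0 := by linarith
  have h5 := hρ.ne'
  simp [a0, h4, h5] at h3

end

/-! ### The thinned gamma process -/

/-- The recursions on the two sides of time `0` are mirror images. -/
theorem IsThinnedGammaProcess.reflect {Ω : Type*} [MeasurableSpace Ω] {P : Measure Ω}
    {α β ρ : ℝ} {Y : ℤ → Ω → ℝ} (h : IsThinnedGammaProcess α β ρ Y P) :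
    IsThinnedGammaProcess α β ρ (fun n => Y (-n)) P := by
  obtain ⟨B, ζ, hY0, hB, hζ, lY, lB, lζ, hind, hp, hn⟩ := h
  let r : {t : ℤ // t ≠ 0} → {t : ℤ // t ≠ 0} := fun t => ⟨-t, neg_ne_zero.2 t.2⟩
  have hr : Function.Injective r := fun s t hst => by
    have : -(s : ℤ) = -t := congrArg Subtype.val hst
    exact Subtype.ext (by linarith)
  refine ⟨fun t => B (r t), fun t => ζ (r t), by simpa using hY0, fun t => hB _, fun t => hζ _,
    by simpa using lY, fun t => lB _, fun t => lζ _, ?_, ?_, ?_⟩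
  · have hg : Function.Injective (Option.map (Sum.map r r)) :=
      Option.map_injective (Sum.map_injective.2 ⟨hr, hr⟩)
    have := hind.precomp hg
    refine (iIndepFun_congr fun i => ?_).1 this
    rcases i with _ | i | i
    · simp
    · simp
    · simp
  · intro t ht ω
    have := hn (r t) (by simpa [r] using ht) ω
    simpa [r, neg_sub, neg_add_eq_sub] using this
  · intro t ht ω
    have := hp (r t) (by simpa [r] using ht) ω
    simpa [r, neg_add, sub_eq_add_neg, add_comm] using this

/-- Forward step: values at times `≤ n`, negative ones included, involve only coefficients with
index `≤ n`, so for `k ≤ n` and `0 ≤ n` the coefficients of the step from `n` to `n + 1` are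
independent of `(Y k, Y n)`. -/
theorem IsThinnedGammaProcess.map_succ {Ω : Type*} [MeasurableSpace Ω] {P : Measure Ω}
    [IsProbabilityMeasure P] {α β ρ : ℝ} {Y : ℤ → Ω → ℝ} (h : IsThinnedGammaProcess α β ρ Y P) :
    (∀ n, Measurable (Y n)) ∧ ∀ k n : ℤ, k ≤ n → 0 ≤ n →
      P.map (fun ω => (Y k ω, Y (n + 1) ω)) =
        thinStep α β ρ (P.map fun ω => (Y k ω, Y n ω)) := by
  obtain ⟨B, ζ, hY0, hB, hζ, lY, lB, lζ, hind, hp, hn⟩ := h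
  let W : Option ({t : ℤ // t ≠ 0} ⊕ {t : ℤ // t ≠ 0}) → Ω → ℝ :=
    fun i => i.elim (Y 0) (Sum.elim B ζ)
  have hW : ∀ i, Measurable (W i) := by
    rintro (_ | i | i)
    · exact hY0
    · exact hB i
    · exact hζ i
  let m : Option ({t : ℤ // t ≠ 0} ⊕ {t : ℤ // t ≠ 0}) → MeasurableSpace Ω :=
    fun i => MeasurableSpace.comap (W i) inferInstance
  -- the index of a variable that enters the values at times `≤ n` only
  let S : ℤ → Set (Option ({t : ℤ // t ≠ 0} ⊕ {t : ℤ // t ≠ 0})) := fun n =>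
    {i | ∀ t : {t : ℤ // t ≠ 0}, (i = some (Sum.inl t) ∨ i = some (Sum.inr t)) → (t : ℤ) ≤ n}
  let F : ℤ → MeasurableSpace Ω := fun n => ⨆ i ∈ S n, m i
  have hWF : ∀ n, ∀ i ∈ S n, Measurable[F n] (W i) := fun n i hi =>
    (comap_measurable (W i)).mono (le_iSup₂_of_le i hi le_rfl) le_rfl
  have hF : ∀ n, F n ≤ ‹MeasurableSpace Ω› := fun n => iSup₂_le fun i _ => (hW i).comap_le
  have hS0 : ∀ n, (none : Option ({t : ℤ // t ≠ 0} ⊕ {t : ℤ // t ≠ 0})) ∈ S n := by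
    intro n t ht
    simp at ht
  have hSB : ∀ (n : ℤ) (t : {t : ℤ // t ≠ 0}), (t : ℤ) ≤ n → some (Sum.inl t) ∈ S n := by
    rintro n t ht s (hs | hs)
    · cases hs; exact ht
    · cases hs
  have hSζ : ∀ (n : ℤ) (t : {t : ℤ // t ≠ 0}), (t : ℤ) ≤ n → some (Sum.inr t) ∈ S n := by
    rintro n t ht s (hs | hs)
    · cases hs
    · cases hs; exact ht
  have hneg : ∀ (k : ℕ) (n : ℤ), 0 ≤ n → Measurable[F n] (Y (-k)) := by
    intro k n hn0
    induction k with
    | zero => exact hWF n none (hS0 n)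
    | succ k ih =>
      let t : {t : ℤ // t ≠ 0} := ⟨-((k + 1 : ℕ) : ℤ), by omega⟩
      have ht : (t : ℤ) < 0 := by simp only [t]; omega
      have e : Y (-((k + 1 : ℕ) : ℤ)) = fun ω => B t ω * Y (-k) ω + ζ t ω := by
        funext ω
        have := hn t ht ω
        rw [show (t : ℤ) + 1 = -k by simp only [t]; omega] at this
        exact this
      rw [e]
      have h1 : Measurable[F n] (B t) := hWF n _ (hSB n t (by omega))
      have h2 : Measurable[F n] (ζ t) := hWF n _ (hSζ n t (by omega))
      exact (h1.mul ih).add h2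
  have hpos : ∀ (k : ℕ) (n : ℤ), (k : ℤ) ≤ n → Measurable[F n] (Y k) := by
    intro k n hn0
    induction k with
    | zero => exact hWF n none (hS0 n)
    | succ k ih =>
      let t : {t : ℤ // t ≠ 0} := ⟨((k + 1 : ℕ) : ℤ), by omega⟩
      have ht : 0 < (t : ℤ) := by simp only [t]; omega
      have e : Y ((k + 1 : ℕ) : ℤ) = fun ω => B t ω * Y k ω + ζ t ω := by
        funext ω
        have := hp t ht ω
        rw [show (t : ℤ) - 1 = k by simp only [t]; omega] at this
        exact this
      rw [e]
      have h1 : Measurable[F n] (B t) := hWF n _ (hSB n t hn0)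
      have h2 : Measurable[F n] (ζ t) := hWF n _ (hSζ n t hn0)
      exact (h1.mul (ih (by omega))).add h2
  have hYF : ∀ k n : ℤ, k ≤ n → 0 ≤ n → Measurable[F n] (Y k) := by
    intro k n hkn hn0
    rcases le_total 0 k with hk | hk
    · lift k to ℕ using hk
      exact hpos k n hkn
    · obtain ⟨j, rfl⟩ : ∃ j : ℕ, k = -j := ⟨(-k).toNat, by omega⟩
      exact hneg j n hn0
  have hYm : ∀ n, Measurable (Y n) := fun n =>
    (hYF n (max n 0) (le_max_left _ _) (le_max_right _ _)).mono (hF _) le_rfl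
  refine ⟨hYm, fun k n hkn hn0 => ?_⟩
  let t : {t : ℤ // t ≠ 0} := ⟨n + 1, by omega⟩
  have ht : 0 < (t : ℤ) := by simp only [t]; omega
  have e : Y (n + 1) = fun ω => B t ω * Y n ω + ζ t ω := by
    funext ω
    have := hp t ht ω
    rw [show (t : ℤ) - 1 = n by simp only [t]; omega] at this
    exact this
  rw [e]
  have hBζ : IndepFun (B t) (ζ t) P :=
    hind.indepFun (i := some (Sum.inl t)) (j := some (Sum.inr t)) (by simp)
  refine map_eq_thinStep (Z := fun ω => (Y k ω, Y n ω)) ((hYm k).prodMk (hYm n)) (hB t) (hζ t)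
    (lB t) (lζ t) hBζ ?_
  let T : Set (Option ({t : ℤ // t ≠ 0} ⊕ {t : ℤ // t ≠ 0})) :=
    {some (Sum.inl t), some (Sum.inr t)}
  have hST : Disjoint (S n) T := by
    rw [Set.disjoint_right]
    rintro i (hi | hi) hi'
    · have := hi' t (Or.inl hi); simp only [t] at this; omega
    · have := hi' t (Or.inr hi); simp only [t] at this; omega
  have hI := indep_iSup_of_disjoint (fun i => (hW i).comap_le) hind.iIndep hST
  have hWT : ∀ i ∈ T, Measurable[⨆ i ∈ T, m i] (W i) := fun i hi =>
    (comap_measurable (W i)).mono (le_iSup₂_of_le i hi le_rfl) le_rfl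
  have hZ : Measurable[F n] (fun ω => (Y k ω, Y n ω)) :=
    Measurable.prodMk (hYF k n hkn hn0) (hYF n n le_rfl hn0)
  have hC : Measurable[⨆ i ∈ T, m i] (fun ω => (B t ω, ζ t ω)) :=
    Measurable.prodMk (hWT (some (Sum.inl t)) (by simp [T])) (hWT (some (Sum.inr t)) (by simp [T]))
  rw [IndepFun_iff_Indep]
  exact indep_of_indep_of_le_left (indep_of_indep_of_le_right hI hC.comap_le) hZ.comap_le

section
variable {Ω : Type*} [MeasurableSpace Ω] {P : Measure Ω} [IsProbabilityMeasure P] {α β ρ : ℝ}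
  {Y : ℤ → Ω → ℝ}

theorem IsThinnedGammaProcess.map_pair_of_nonneg (hα : 0 < α) (hβ : 0 < β) (hρ : 0 < ρ)
    (hρ1 : ρ < 1) (h : IsThinnedGammaProcess α β ρ Y P) (n : ℕ) :
    P.map (fun ω => (Y n ω, Y (n + 1) ω)) = thinPair α β ρ := by
  obtain ⟨hYm, hstep⟩ := h.map_succ
  have diag : ∀ n : ℤ, P.map (fun ω => (Y n ω, Y n ω)) = (P.map (Y n)).map fun x => (x, x) := by
    intro n
    rw [Measure.map_map (by fun_prop) (hYm n)]
    rfl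
  have hpair : ∀ n : ℕ, P.map (Y n) = gammaMeasure α β →
      P.map (fun ω => (Y n ω, Y (n + 1) ω)) = thinPair α β ρ := fun n hl => by
    rw [hstep n n le_rfl (by omega), diag, hl, thinPair]
  refine hpair n ?_
  induction n with
  | zero => obtain ⟨B, ζ, -, -, -, lY, -⟩ := h; exact lY
  | succ n ih =>
    have h2 := congrArg (fun μ => μ.map Prod.snd) (hpair n ih)
    simp only [map_snd_thinPair hα hβ hρ hρ1] at h2
    rw [Measure.map_map (by fun_prop) (by fun_prop)] at h2
    exact_mod_cast h2

theorem IsThinnedGammaProcess.measurable (h : IsThinnedGammaProcess α β ρ Y P) (n : ℤ) :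
    Measurable (Y n) := h.map_succ.1 n

theorem IsThinnedGammaProcess.map_pair (hα : 0 < α) (hβ : 0 < β) (hρ : 0 < ρ)
    (hρ1 : ρ < 1) (h : IsThinnedGammaProcess α β ρ Y P) (n : ℤ) :
    P.map (fun ω => (Y n ω, Y (n + 1) ω)) = thinPair α β ρ := by
  have := h.measurable
  rcases le_or_gt 0 n with hn | hn
  · lift n to ℕ using hn
    exact h.map_pair_of_nonneg hα hβ hρ hρ1 n
  · obtain ⟨k, rfl⟩ : ∃ k : ℕ, n = -(k + 1) := ⟨(-n - 1).toNat, by omega⟩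
    have h1 := h.reflect.map_pair_of_nonneg hα hβ hρ hρ1 k
    rw [← map_swap_thinPair hα hβ hρ hρ1, ← h1, Measure.map_map (by fun_prop) (by fun_prop)]
    simp [Function.comp_def]

/-- Two steps of the thinned gamma process do not have the pair law with parameter `ρ ^ 2`. For
`n ≥ -1` the step into time `n + 2` is a forward step; the remaining times follow by reflection. -/
theorem IsThinnedGammaProcess.map_skip_ne (hα : 0 < α) (hβ : 0 < β) (hρ : 0 < ρ)
    (hρ1 : ρ < 1) (h : IsThinnedGammaProcess α β ρ Y P) (n : ℤ) :
    P.map (fun ω => (Y n ω, Y (n + 2) ω)) ≠ thinPair α β (ρ ^ 2) := by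
  have forward : ∀ {Y : ℤ → Ω → ℝ}, IsThinnedGammaProcess α β ρ Y P → ∀ n : ℤ, -1 ≤ n →
      P.map (fun ω => (Y n ω, Y (n + 2) ω)) ≠ thinPair α β (ρ ^ 2) := by
    intro Y h n hn
    have h1 := h.map_succ.2 n (n + 1) (by omega) (by omega)
    rw [h.map_pair hα hβ hρ hρ1, show n + 1 + 1 = n + 2 by ring] at h1
    rw [h1]
    exact thinStep_thinPair_ne hα hβ hρ hρ1
  rcases le_or_gt (-1) n with hn | hn
  · exact forward h n hn
  · intro h0
    have := h.measurable
    refine forward h.reflect (-(n + 2)) (by omega) ?_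
    rw [← map_swap_thinPair hα hβ (by positivity) (by nlinarith), ← h0,
      Measure.map_map (by fun_prop) (by fun_prop)]
    simp [Function.comp_def]

end

/-! ### The Markov property -/

/-- If a Markov process has at times `t₁ ≤ t₂` the pair law of the thinned gamma chain, then, for
`t₀ ≤ t₁`, the thinning step leads from `(X t₀, X t₁)` to `(X t₀, X t₂)`. -/
theorem IsMarkovProcess.map_skip {T Ω : Type*} [Preorder T] [MeasurableSpace Ω] {P : Measure Ω}
    [IsProbabilityMeasure P] {α β ρ : ℝ} (hα : 0 < α) (hβ : 0 < β) (hρ : 0 < ρ) (hρ1 : ρ < 1)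
    {X : T → Ω → ℝ} (hX : ∀ t, Measurable (X t)) (hM : IsMarkovProcess X P) {t₀ t₁ t₂ : T}
    (h01 : t₀ ≤ t₁) (h12 : t₁ ≤ t₂)
    (l12 : P.map (fun ω => (X t₁ ω, X t₂ ω)) = thinPair α β ρ) :
    P.map (fun ω => (X t₀ ω, X t₂ ω)) =
      thinStep α β ρ (P.map fun ω => (X t₀ ω, X t₁ ω)) := by
  have iL := isProbabilityMeasure_thinningLaw hα hβ hρ hρ1
  have iG := isProbabilityMeasure_gammaMeasure hα hβ
  -- the transition probabilities of the thinning step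
  let K : Set ℝ → ℝ → ENNReal := fun A y => thinningLaw α β ρ {p | p.1 * y + p.2 ∈ A}
  have hKm : ∀ A, MeasurableSet A → Measurable (K A) := by
    intro A hA
    have : MeasurableSet {q : ℝ × (ℝ × ℝ) | q.2.1 * q.1 + q.2.2 ∈ A} :=
      (show Measurable fun q : ℝ × (ℝ × ℝ) => q.2.1 * q.1 + q.2.2 by fun_prop) hA
    exact measurable_measure_prodMk_left this
  have hKX : ∀ A, MeasurableSet A → Measurable fun ω => K A (X t₁ ω) := fun A hA =>
    (hKm A hA).comp (hX t₁)
  have hstep : ∀ (μ : Measure (ℝ × ℝ)) [IsProbabilityMeasure μ] (C A : Set ℝ), MeasurableSet C →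
      MeasurableSet A → thinStep α β ρ μ (C ×ˢ A) =
        ∫⁻ p, C.indicator (fun _ => 1) p.1 * K A p.2 ∂μ := by
    intro μ _ C A hC hA
    have hm : Measurable fun p : (ℝ × ℝ) × ℝ × ℝ => (p.1.1, p.2.1 * p.1.2 + p.2.2) := by fun_prop
    rw [thinStep, Measure.map_apply hm (hC.prod hA), Measure.prod_apply (hm (hC.prod hA))]
    refine lintegral_congr fun p => ?_
    by_cases hp : p.1 ∈ C
    · simp [hp, K, Set.preimage, Set.mem_prod]
    · simp [hp, Set.preimage, Set.mem_prod]
  have l1 : P.map (X t₁) = gammaMeasure α β := by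
    rw [← map_fst_thinPair hα hβ hρ hρ1, ← l12, Measure.map_map (by fun_prop)
      ((hX _).prodMk (hX _))]
    rfl
  have hpair : ∀ C A : Set ℝ, MeasurableSet C → MeasurableSet A →
      P (X t₁ ⁻¹' C ∩ X t₂ ⁻¹' A) = ∫⁻ ω in X t₁ ⁻¹' C, K A (X t₁ ω) ∂P := by
    intro C A hC hA
    have i1 : IsProbabilityMeasure ((gammaMeasure α β).map fun x => (x, x)) :=
      Measure.isProbabilityMeasure_map (by fun_prop)
    have h1 := congrArg (fun μ => μ (C ×ˢ A)) l12
    have m1 : Measurable fun p : ℝ × ℝ => C.indicator (fun _ => (1 : ENNReal)) p.1 * K A p.2 :=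
      ((measurable_const.indicator hC).comp measurable_fst).mul ((hKm A hA).comp measurable_snd)
    rw [Measure.map_apply ((hX _).prodMk (hX _)) (hC.prod hA), thinPair, hstep _ C A hC hA,
      lintegral_map m1 (by fun_prop), ← l1, lintegral_map (by fun_prop) (hX _)] at h1
    rw [← lintegral_indicator (hX _ hC)]
    refine (show _ = _ from h1).trans (lintegral_congr fun ω => ?_)
    by_cases hp : X t₁ ω ∈ C
    · simp [hp]
    · simp [hp]
  have hm1 : MeasurableSpace.comap (X t₁) (borel ℝ) ≤ ‹MeasurableSpace Ω› := by
    rw [← BorelSpace.measurable_eq (α := ℝ)]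
    exact (hX t₁).comap_le
  have hF : (⨆ (u : T) (_ : u ≤ t₁), MeasurableSpace.comap (X u) (borel ℝ)) ≤
      ‹MeasurableSpace Ω› := by
    rw [← BorelSpace.measurable_eq (α := ℝ)]
    exact iSup₂_le fun u _ => (hX u).comap_le
  have hK1 : ∀ A y, K A y ≤ 1 := fun A y => prob_le_one
  -- `K A (X t₁)` is the conditional probability of `X t₂ ∈ A` given `X t₁`
  have hcond : ∀ A : Set ℝ, MeasurableSet A → (fun ω => (K A (X t₁ ω)).toReal) =ᵐ[P]
      condExp (MeasurableSpace.comap (X t₁) (borel ℝ)) P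
        ((X t₂ ⁻¹' A).indicator fun _ => (1 : ℝ)) := by
    intro A hA
    have hint : Integrable (fun ω => (K A (X t₁ ω)).toReal) P := by
      refine Integrable.of_bound (C := 1)
        (hKX A hA).ennreal_toReal.aestronglyMeasurable (ae_of_all _ fun ω => ?_)
      simpa using ENNReal.toReal_mono ENNReal.one_ne_top (hK1 A (X t₁ ω))
    refine ae_eq_condExp_of_forall_setIntegral_eq hm1
      ((integrable_const 1).indicator (hX _ hA)) (fun _ _ _ => hint.integrableOn) ?_ ?_
    · rintro s ⟨C, hC, rfl⟩ -
      have hC' : MeasurableSet C := by rwa [← BorelSpace.measurable_eq (α := ℝ)] at hC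
      rw [integral_toReal (hKX A hA).aemeasurable
        (ae_of_all _ fun ω => (hK1 A _).trans_lt ENNReal.one_lt_top), ← hpair C A hC' hA,
        integral_indicator (hX _ hA), Measure.restrict_restrict (hX _ hA)]
      simp [Measure.real, Set.inter_comm]
    · refine Measurable.aestronglyMeasurable ?_
      refine ((hKm A hA).ennreal_toReal).comp ?_
      rw [BorelSpace.measurable_eq (α := ℝ)]
      exact comap_measurable _
  have im : IsProbabilityMeasure (P.map fun ω => (X t₀ ω, X t₁ ω)) :=
    Measure.isProbabilityMeasure_map ((hX _).prodMk (hX _)).aemeasurable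
  have im' : IsProbabilityMeasure (P.map fun ω => (X t₀ ω, X t₂ ω)) :=
    Measure.isProbabilityMeasure_map ((hX _).prodMk (hX _)).aemeasurable
  have is := isProbabilityMeasure_thinStep hα hβ hρ hρ1 (P.map fun ω => (X t₀ ω, X t₁ ω))
  refine Measure.ext_prod fun {C A} hC hA => ?_
  have m1 : Measurable fun p : ℝ × ℝ => C.indicator (fun _ => (1 : ENNReal)) p.1 * K A p.2 :=
    ((measurable_const.indicator hC).comp measurable_fst).mul ((hKm A hA).comp measurable_snd)
  rw [hstep _ C A hC hA, lintegral_map m1 ((hX _).prodMk (hX _)),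
    Measure.map_apply ((hX _).prodMk (hX _)) (hC.prod hA)]
  have hCF : MeasurableSet[⨆ (u : T) (_ : u ≤ t₁), MeasurableSpace.comap (X u) (borel ℝ)]
      (X t₀ ⁻¹' C) := by
    refine (le_iSup₂_of_le (f := fun (u : T) (_ : u ≤ t₁) =>
      MeasurableSpace.comap (X u) (borel ℝ)) t₀ h01 le_rfl) _ ⟨C, ?_, rfl⟩
    rwa [← BorelSpace.measurable_eq (α := ℝ)]
  have h2 := setIntegral_condExp hF
    (((integrable_const (1 : ℝ)).indicator (hX t₂ hA)) : Integrable _ P) hCF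
  rw [integral_indicator (hX _ hA), Measure.restrict_restrict (hX _ hA)] at h2
  have h3 : ∫ ω in X t₀ ⁻¹' C, condExp (⨆ (u : T) (_ : u ≤ t₁),
      MeasurableSpace.comap (X u) (borel ℝ)) P ((X t₂ ⁻¹' A).indicator fun _ => (1 : ℝ)) ω ∂P =
      ∫ ω in X t₀ ⁻¹' C, (K A (X t₁ ω)).toReal ∂P :=
    integral_congr_ae (ae_restrict_of_ae ((hM t₁ t₂ h12 A hA).trans (hcond A hA).symm))
  rw [h3, integral_toReal (hKX A hA).aemeasurable
    (ae_of_all _ fun ω => (hK1 A _).trans_lt ENNReal.one_lt_top)] at h2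
  simp only [integral_const, smul_eq_mul, mul_one, Measure.real, Measure.restrict_apply,
    MeasurableSet.univ, Set.univ_inter] at h2
  have h4 : ∫⁻ ω in X t₀ ⁻¹' C, K A (X t₁ ω) ∂P = P (X t₀ ⁻¹' C ∩ X t₂ ⁻¹' A) := by
    rw [Set.inter_comm]
    refine (ENNReal.toReal_eq_toReal_iff' ?_ (measure_ne_top _ _)).1 h2
    refine ((setLIntegral_mono measurable_const fun ω _ => hK1 A _).trans_lt ?_).ne
    simp
  refine (show _ = P (X t₀ ⁻¹' C ∩ X t₂ ⁻¹' A) from rfl).trans ?_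
  rw [← h4, ← lintegral_indicator (hX _ hC)]
  refine lintegral_congr fun ω => ?_
  by_cases hp : X t₀ ω ∈ C
  · simp [hp]
  · simp [hp]

/-- A process cannot be Markov if its two consecutive pair laws have parameter `ρ` while the pair
law across both steps has parameter `ρ ^ 2`. -/
theorem not_isMarkovProcess_of_thinPair {T Ω : Type*} [Preorder T] [MeasurableSpace Ω]
    {P : Measure Ω} [IsProbabilityMeasure P] {α β ρ : ℝ} (hα : 0 < α) (hβ : 0 < β) (hρ : 0 < ρ)
    (hρ1 : ρ < 1) {X : T → Ω → ℝ} (hX : ∀ t, Measurable (X t)) {t₀ t₁ t₂ : T}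
    (h01 : t₀ ≤ t₁) (h12 : t₁ ≤ t₂)
    (l01 : P.map (fun ω => (X t₀ ω, X t₁ ω)) = thinPair α β ρ)
    (l12 : P.map (fun ω => (X t₁ ω, X t₂ ω)) = thinPair α β ρ)
    (l02 : P.map (fun ω => (X t₀ ω, X t₂ ω)) = thinPair α β (ρ ^ 2)) :
    ¬ IsMarkovProcess X P := by
  intro hM
  have h := hM.map_skip hα hβ hρ hρ1 hX h01 h12 l12
  rw [l01, l02] at h
  exact thinStep_thinPair_ne hα hβ hρ hρ1 h.symm

/-! ### The regions and their areas -/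

theorem measurableSet_gammaRegion (lam t : ℝ) : MeasurableSet (gammaRegion lam t) :=
  (measurableSet_le measurable_const measurable_snd).inter
    (measurableSet_lt measurable_snd (by fun_prop))

theorem lintegral_exp_neg_mul_abs {c : ℝ} (hc : 0 < c) :
    ∫⁻ x : ℝ, ENNReal.ofReal (Real.exp (-c * |x|)) = ENNReal.ofReal (2 / c) := by
  have h : ∫ x : ℝ, Real.exp (-c * |x|) = 2 / c := by
    rw [integral_comp_abs (f := fun x => Real.exp (-c * x)), integral_exp_mul_Ioi (by linarith)]
    simp
    ring
  have hint : Integrable fun x : ℝ => Real.exp (-c * |x|) :=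
    -- the integral of a nonintegrable function would be `0`
    Integrable.of_integral_ne_zero (by rw [h]; positivity)
  rw [← ofReal_integral_eq_lintegral_ofReal hint (ae_of_all _ fun x => (Real.exp_pos _).le), h]

theorem max_abs_sub (s t x : ℝ) :
    max |s - x| |t - x| = |x - (s + t) / 2| + |s - t| / 2 := by
  rcases le_total s t with h | h
  · rw [abs_of_nonpos (sub_nonpos.2 h)]
    rcases le_total x ((s + t) / 2) with hx | hx
    · rw [abs_of_nonpos (a := x - (s + t) / 2) (by linarith),
        max_eq_right (abs_le_abs (by linarith) (by linarith)), abs_of_nonneg (by linarith)]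
      ring
    · rw [abs_of_nonneg (a := x - (s + t) / 2) (by linarith), max_eq_left, abs_of_nonpos] <;>
      first
      | linarith
      | (rw [abs_of_nonpos (a := s - x) (by linarith)]; exact abs_le.2 ⟨by linarith, by linarith⟩)
  · rw [abs_of_nonneg (sub_nonneg.2 h)]
    rcases le_total x ((s + t) / 2) with hx | hx
    · rw [abs_of_nonpos (a := x - (s + t) / 2) (by linarith),
        max_eq_left (abs_le_abs (by linarith) (by linarith)), abs_of_nonneg (by linarith)]
      ring
    · rw [abs_of_nonneg (a := x - (s + t) / 2) (by linarith), max_eq_right, abs_of_nonpos] <;>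
      first
      | linarith
      | (rw [abs_of_nonpos (a := t - x) (by linarith)]; exact abs_le.2 ⟨by linarith, by linarith⟩)

/-- The fibre of the intersection over `x` is an interval whose length decays exponentially in the
distance of `x` from the midpoint of `s` and `t`. -/
theorem volume_inter_gammaRegion {lam : ℝ} (hlam : 0 < lam) (s t : ℝ) :
    volume (gammaRegion lam s ∩ gammaRegion lam t) =
      ENNReal.ofReal (Real.exp (-lam * |s - t|)) := by
  have hfib : ∀ x : ℝ, Prod.mk x ⁻¹' (gammaRegion lam s ∩ gammaRegion lam t) =
      Set.Ico 0 (lam * Real.exp (-lam * |s - t|) * Real.exp (-(2 * lam) * |x - (s + t) / 2|)) := by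
    intro x
    have h : lam * Real.exp (-lam * |s - t|) * Real.exp (-(2 * lam) * |x - (s + t) / 2|) =
        min (lam * Real.exp (-2 * lam * |s - x|)) (lam * Real.exp (-2 * lam * |t - x|)) := by
      have hf : Antitone fun v => lam * Real.exp (-2 * lam * v) := fun v w hvw => by
        simp only
        gcongr lam * Real.exp ?_
        nlinarith
      rw [← hf.map_max, max_abs_sub, mul_assoc, ← Real.exp_add]
      congr 2
      ring
    ext y
    simp only [h, gammaRegion, Set.mem_preimage, Set.mem_inter_iff, Set.mem_ofPred_eq, Set.mem_Ico,
      lt_min_iff]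
    tauto
  rw [Measure.volume_eq_prod, Measure.prod_apply ((measurableSet_gammaRegion _ _).inter
    (measurableSet_gammaRegion _ _))]
  simp only [hfib, Real.volume_Ico, sub_zero]
  have h0 : 0 ≤ lam * Real.exp (-lam * |s - t|) := by positivity
  simp only [ENNReal.ofReal_mul h0]
  rw [lintegral_const_mul _ (by fun_prop),
    lintegral_sub_right_eq_self (fun x => ENNReal.ofReal (Real.exp (-(2 * lam) * |x|)))
      ((s + t) / 2), lintegral_exp_neg_mul_abs (by linarith), ← ENNReal.ofReal_mul h0]
  congr 1
  field_simp

theorem volume_gammaRegion {lam : ℝ} (hlam : 0 < lam) (t : ℝ) :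
    volume (gammaRegion lam t) = 1 := by
  simpa using volume_inter_gammaRegion hlam t t

theorem gammaRegion_add (lam t h : ℝ) :
    gammaRegion lam t = (fun p : ℝ × ℝ => p + (h, 0)) ⁻¹' gammaRegion lam (t + h) := by
  ext p
  simp [gammaRegion]

theorem volume_sdiff_gammaRegion {lam : ℝ} (hlam : 0 < lam) (s t : ℝ) :
    volume (gammaRegion lam s \ gammaRegion lam t) =
      ENNReal.ofReal (1 - Real.exp (-lam * |s - t|)) := by
  rw [← Set.sdiff_self_inter, measure_sdiff Set.inter_subset_left
    ((measurableSet_gammaRegion _ _).inter (measurableSet_gammaRegion _ _)).nullMeasurableSet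
    (by simp [volume_inter_gammaRegion hlam]), volume_inter_gammaRegion hlam,
    volume_gammaRegion hlam, ENNReal.ofReal_sub _ (Real.exp_pos _).le, ENNReal.ofReal_one]

/-! ### Gamma random measures of finite families of sets -/

theorem IsGammaRandomMeasure.iIndepFun_toReal {Ω : Type*} [MeasurableSpace Ω] {P : Measure Ω}
    {α β : ℝ} {G : Ω → Measure (ℝ × ℝ)} (hG : IsGammaRandomMeasure α β G P) {κ : Type*} [Fintype κ]
    {A : κ → Set (ℝ × ℝ)} (hA : ∀ i, MeasurableSet (A i)) (hv : ∀ i, volume (A i) ≠ ⊤)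
    (hd : Pairwise fun i j => Disjoint (A i) (A j)) :
    iIndepFun (fun i ω => (G ω (A i)).toReal) P := by
  let e := Fintype.equivFin κ
  have h := hG.indep _ (fun i => A (e.symm i)) (fun i => hA _) (fun i => hv _)
    fun i j hij => hd (e.symm.injective.ne hij)
  have h1 := (h.precomp e.injective).comp (fun _ => ENNReal.toReal)
    fun _ => ENNReal.measurable_toReal
  simpa [Function.comp_def] using h1

theorem IsGammaRandomMeasure.measurable_apply {Ω : Type*} [MeasurableSpace Ω] {P : Measure Ω}
    {α β : ℝ} {G : Ω → Measure (ℝ × ℝ)} (hG : IsGammaRandomMeasure α β G P) {A : Set (ℝ × ℝ)}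
    (hA : MeasurableSet A) : Measurable fun ω => G ω A :=
  (Measure.measurable_coe hA).comp hG.measurable

theorem IsGammaRandomMeasure.map_toReal {Ω : Type*} [MeasurableSpace Ω] {P : Measure Ω}
    {α β : ℝ} {G : Ω → Measure (ℝ × ℝ)} (hG : IsGammaRandomMeasure α β G P) {A : Set (ℝ × ℝ)}
    (hA : MeasurableSet A) (hv : volume A ≠ ⊤) :
    P.map (fun ω => (G ω A).toReal) = gammaLaw (α * (volume A).toReal) β := by
  have h := congrArg (fun μ => μ.map ENNReal.toReal) (hG.law A hA hv)
  rw [Measure.map_map (by fun_prop) (hG.measurable_apply hA),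
    Measure.map_map (by fun_prop) (by fun_prop)] at h
  refine (show _ = _ from h).trans ?_
  refine (Measure.map_congr ?_).trans Measure.map_id
  filter_upwards [ae_nonneg_gammaLaw (α * (volume A).toReal) β] with x hx
  simp [hx]

theorem IsGammaRandomMeasure.ae_ne_top {Ω : Type*} [MeasurableSpace Ω] {P : Measure Ω}
    {α β : ℝ} {G : Ω → Measure (ℝ × ℝ)} (hG : IsGammaRandomMeasure α β G P) {A : Set (ℝ × ℝ)}
    (hA : MeasurableSet A) (hv : volume A ≠ ⊤) : ∀ᵐ ω ∂P, G ω A ≠ ⊤ := by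
  have h : ∀ᵐ y ∂P.map (fun ω => G ω A), y ≠ ⊤ := by
    rw [hG.law A hA hv]
    exact (ae_map_iff (by fun_prop) (measurableSet_singleton _).compl).2 (ae_of_all _ (by simp))
  exact ae_of_ae_map (hG.measurable_apply hA).aemeasurable h

/-- The atom of the Venn diagram of the family `D` consisting of the points that lie in exactly the
sets `D i` with `i ∈ S`; the points outside all sets, where the area is infinite, are left out. -/
def vennAtom {ι E : Type*} (D : ι → Set E) (S : Finset ι) : Set E :=
  {p | (∃ i, p ∈ D i) ∧ ∀ i, p ∈ D i ↔ i ∈ S}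

section
variable {ι E : Type*} [Fintype ι] (D : ι → Set E)

omit [Fintype ι] in
theorem disjoint_vennAtom : Pairwise fun S T => Disjoint (vennAtom D S) (vennAtom D T) := by
  intro S T hST
  rw [Set.disjoint_left]
  rintro p ⟨-, hS⟩ ⟨-, hT⟩
  exact hST (Finset.ext fun i => (hS i).symm.trans (hT i))

theorem measurableSet_vennAtom [MeasurableSpace E] (hD : ∀ i, MeasurableSet (D i))
    (S : Finset ι) : MeasurableSet (vennAtom D S) := by
  have : vennAtom D S = (⋃ i, D i) ∩ ⋂ i, {p | p ∈ D i ↔ i ∈ S} := by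
    ext p; simp [vennAtom]
  rw [this]
  refine (MeasurableSet.iUnion hD).inter (MeasurableSet.iInter fun i => ?_)
  by_cases hi : i ∈ S
  · simpa [hi] using hD i
  · simp only [hi, iff_false]
    exact (hD i).compl

omit [Fintype ι] in
theorem vennAtom_subset : ∀ S, vennAtom D S ⊆ ⋃ i, D i := fun _ _ hp => Set.mem_iUnion.2 hp.1

theorem iUnion_vennAtom [DecidableEq ι] (i : ι) :
    ⋃ S ∈ (Finset.univ : Finset (Finset ι)).filter (i ∈ ·), vennAtom D S = D i := by
  classical
  ext p
  simp only [Finset.mem_filter, Finset.mem_univ, true_and, Set.mem_iUnion, exists_prop]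
  constructor
  · rintro ⟨S, hi, -, hS⟩
    exact (hS i).2 hi
  · intro hp
    exact ⟨Finset.univ.filter (p ∈ D ·), by simpa using hp, ⟨i, hp⟩, by simp⟩

end

/-- The linear map that adds up the values of the Venn diagram atoms contained in each set. -/
noncomputable def atomSum (ι : Type*) [Fintype ι] [DecidableEq ι] :
    (Finset ι → ℝ) →L[ℝ] (ι → ℝ) :=
  ContinuousLinearMap.pi fun i =>
    ∑ S ∈ (Finset.univ : Finset (Finset ι)).filter (i ∈ ·), ContinuousLinearMap.proj S

/-- The joint law of the values of a gamma random measure on a finite family of sets depends only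
on the areas of the atoms of their Venn diagram. -/
theorem IsGammaRandomMeasure.map_family {Ω : Type*} [MeasurableSpace Ω] {P : Measure Ω}
    [IsProbabilityMeasure P] {α β : ℝ} {G : Ω → Measure (ℝ × ℝ)}
    (hG : IsGammaRandomMeasure α β G P) {ι : Type*} [Fintype ι] [DecidableEq ι]
    {D : ι → Set (ℝ × ℝ)} (hD : ∀ i, MeasurableSet (D i)) (hv : ∀ i, volume (D i) ≠ ⊤) :
    P.map (fun ω i => (G ω (D i)).toReal) =
      (Measure.pi fun S => gammaLaw (α * (volume (vennAtom D S)).toReal) β).map (atomSum ι) := by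
  have hm := measurableSet_vennAtom D hD
  have hv' : ∀ S, volume (vennAtom D S) ≠ ⊤ := fun S =>
    ((measure_mono (vennAtom_subset D S)).trans_lt ((measure_iUnion_fintype_le _ _).trans_lt
      (ENNReal.sum_lt_top.2 fun i _ => (hv i).lt_top))).ne
  have hmeas : ∀ S, Measurable fun ω => (G ω (vennAtom D S)).toReal := fun S =>
    (hG.measurable_apply (hm S)).ennreal_toReal
  have hind := hG.iIndepFun_toReal hm hv' (disjoint_vennAtom D)
  have hpi := hind.map_fun_eq_pi_map fun S => (hmeas S).aemeasurable
  simp only [hG.map_toReal (hm _) (hv' _)] at hpi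
  rw [← hpi, Measure.map_map (by fun_prop) (measurable_pi_iff.2 hmeas)]
  refine Measure.map_congr ?_
  have hfin : ∀ᵐ ω ∂P, ∀ S, G ω (vennAtom D S) ≠ ⊤ :=
    ae_all_iff.2 fun S => hG.ae_ne_top (hm S) (hv' S)
  filter_upwards [hfin] with ω hω
  funext i
  simp only [atomSum, Function.comp, ContinuousLinearMap.coe_pi', FunLike.coe_sum,
    Finset.sum_apply, ContinuousLinearMap.proj_apply]
  rw [← ENNReal.toReal_sum fun S _ => hω S, ← measure_biUnion_finset
    (fun S _ T _ hST => disjoint_vennAtom D hST) (fun S _ => hm S), iUnion_vennAtom]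

theorem charFunDual_gammaLaw {a b : ℝ} (ha : 0 ≤ a) (hb : 0 < b) (L : StrongDual ℝ ℝ) :
    charFunDual (gammaLaw a b) L = (1 - Complex.I * (L 1 : ℝ) / b) ^ (-a : ℂ) := by
  rw [← charFun_gammaLaw ha hb, charFun_apply_real, charFunDual_apply]
  refine integral_congr_ae (ae_of_all _ fun x => ?_)
  have : L x = L 1 * x := by
    rw [mul_comm, ← smul_eq_mul, ← map_smul]; simp
  simp [this]

/-- Linear images of independent gamma variables have infinitely divisible laws: divide all
shapes by `n`. -/
theorem isInfinitelyDivisibleLaw_map_pi_gammaLaw {κ : Type*} [Fintype κ] {k : ℕ} {b : ℝ}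
    (hb : 0 < b) {a : κ → ℝ} (ha : ∀ i, 0 ≤ a i) (T : (κ → ℝ) →L[ℝ] (Fin k → ℝ)) :
    IsInfinitelyDivisibleLaw ((Measure.pi fun i => gammaLaw (a i) b).map T) := by
  classical
  intro n hn
  have ha' : ∀ i, 0 ≤ a i / n := fun i => div_nonneg (ha i) n.cast_nonneg
  have i1 := fun i => isProbabilityMeasure_gammaLaw (ha i) hb
  have i2 := fun i => isProbabilityMeasure_gammaLaw (ha' i) hb
  have i3 : IsProbabilityMeasure ((Measure.pi fun i => gammaLaw (a i) b).map T) :=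
    Measure.isProbabilityMeasure_map (by fun_prop)
  have i4 : IsProbabilityMeasure ((Measure.pi fun i => gammaLaw (a i / n) b).map T) :=
    Measure.isProbabilityMeasure_map (by fun_prop)
  refine ⟨_, i4, ?_⟩
  have i5 : IsProbabilityMeasure ((Measure.pi fun _ : Fin n =>
      (Measure.pi fun i => gammaLaw (a i / n) b).map T).map fun z => ∑ j, z j) :=
    Measure.isProbabilityMeasure_map (by fun_prop)
  refine Measure.ext_of_charFunDual ?_
  ext L
  rw [charFunDual_map_sum_pi_eq_prod]
  simp only [Finset.prod_const, Finset.card_univ, Fintype.card_fin, Pi.pow_apply, charFunDual_map,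
    charFunDual_pi, charFunDual_gammaLaw (ha' _) hb, charFunDual_gammaLaw (ha _) hb]
  rw [← Finset.prod_pow]
  refine Finset.prod_congr rfl fun i _ => ?_
  rw [← Complex.cpow_mul_nat]
  congr 1
  have : (n : ℂ) ≠ 0 := by exact_mod_cast (by omega : n ≠ 0)
  push_cast
  field_simp

/-! ### The moving region process -/

section
variable {Ω : Type*} [MeasurableSpace Ω] {P : Measure Ω} [IsProbabilityMeasure P] {α β lam : ℝ}
  {G : Ω → Measure (ℝ × ℝ)}

omit [IsProbabilityMeasure P] in
theorem measurable_randomMeasureProcess (hG : IsGammaRandomMeasure α β G P) (t : ℝ) :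
    Measurable (randomMeasureProcess G lam t) :=
  (hG.measurable_apply (measurableSet_gammaRegion lam t)).ennreal_toReal

/-- The joint laws are unchanged by a shift of time, because the atoms of the Venn diagrams of the
regions are translated, and so keep their areas. -/
theorem isStationaryProcess_randomMeasureProcess (hlam : 0 < lam)
    (hG : IsGammaRandomMeasure α β G P) :
    IsStationaryProcess (randomMeasureProcess G lam) P := by
  intro n t h
  have hv : ∀ t, volume (gammaRegion lam t) ≠ ⊤ := fun t => by simp [volume_gammaRegion hlam]
  have h1 := hG.map_family (D := fun i => gammaRegion lam (t i + h))
    (fun i => measurableSet_gammaRegion _ _) fun i => hv _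
  have h2 := hG.map_family (D := fun i => gammaRegion lam (t i))
    (fun i => measurableSet_gammaRegion _ _) fun i => hv _
  refine h1.trans (Eq.trans ?_ h2.symm)
  have hvol : ∀ S, volume (vennAtom (fun i => gammaRegion lam (t i + h)) S) =
      volume (vennAtom (fun i => gammaRegion lam (t i)) S) := by
    intro S
    rw [← measure_preimage_add_right volume ((h, 0) : ℝ × ℝ)]
    congr 1
    ext p
    have e : ∀ i, p ∈ gammaRegion lam (t i) ↔
        p + (h, 0) ∈ gammaRegion lam (t i + h) := fun i => by
      rw [gammaRegion_add lam (t i) h, Set.mem_preimage]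
    simp only [vennAtom, Set.mem_preimage, Set.mem_ofPred_eq, e]
  simp only [hvol]

theorem isInfinitelyDivisibleLaw_randomMeasureProcess (hα : 0 < α) (hβ : 0 < β) (hlam : 0 < lam)
    (hG : IsGammaRandomMeasure α β G P) {k : ℕ} (t : Fin k → ℝ) :
    IsInfinitelyDivisibleLaw (P.map fun ω i => randomMeasureProcess G lam (t i) ω) := by
  have h := hG.map_family (D := fun i => gammaRegion lam (t i))
    (fun i => measurableSet_gammaRegion _ _) fun i => by simp [volume_gammaRegion hlam]
  have h' : (P.map fun ω i => randomMeasureProcess G lam (t i) ω) = _ := h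
  rw [h']
  exact isInfinitelyDivisibleLaw_map_pi_gammaLaw hβ
    (fun S => mul_nonneg hα.le ENNReal.toReal_nonneg) _

omit [IsProbabilityMeasure P] in
theorem map_randomMeasureProcess (hα : 0 < α) (hlam : 0 < lam)
    (hG : IsGammaRandomMeasure α β G P) (t : ℝ) :
    P.map (randomMeasureProcess G lam t) = gammaMeasure α β := by
  have h := hG.map_toReal (measurableSet_gammaRegion lam t) (by simp [volume_gammaRegion hlam])
  rw [volume_gammaRegion hlam, ENNReal.toReal_one, mul_one, gammaLaw_of_pos hα] at h
  exact h

/-- The values at two times are sums `U + V` and `V + W` of independent gamma variables: the masses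
of the differences and of the intersection of the two regions. -/
theorem map_pair_randomMeasureProcess (hlam : 0 < lam)
    (hG : IsGammaRandomMeasure α β G P) (s t : ℝ) :
    P.map (fun ω => (randomMeasureProcess G lam s ω, randomMeasureProcess G lam t ω)) =
      (((gammaLaw (α * (1 - Real.exp (-lam * |s - t|))) β).prod
        (gammaLaw (α * Real.exp (-lam * |s - t|)) β)).prod
        (gammaLaw (α * (1 - Real.exp (-lam * |s - t|))) β)).map
          fun p => (p.1.1 + p.1.2, p.1.2 + p.2) := by
  have ms := measurableSet_gammaRegion lam s
  have mt := measurableSet_gammaRegion lam t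
  let A : Fin 3 → Set (ℝ × ℝ) := ![gammaRegion lam s \ gammaRegion lam t,
    gammaRegion lam s ∩ gammaRegion lam t, gammaRegion lam t \ gammaRegion lam s]
  have hA : ∀ i, MeasurableSet (A i) := by
    intro i
    fin_cases i
    · exact ms.diff mt
    · exact ms.inter mt
    · exact mt.diff ms
  have hle : Real.exp (-lam * |s - t|) ≤ 1 :=
    Real.exp_le_one_iff.2 (by nlinarith [abs_nonneg (s - t)])
  have v0 : volume (A 0) = ENNReal.ofReal (1 - Real.exp (-lam * |s - t|)) :=
    volume_sdiff_gammaRegion hlam s t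
  have v1 : volume (A 1) = ENNReal.ofReal (Real.exp (-lam * |s - t|)) :=
    volume_inter_gammaRegion hlam s t
  have v2 : volume (A 2) = ENNReal.ofReal (1 - Real.exp (-lam * |s - t|)) := by
    rw [abs_sub_comm]
    exact volume_sdiff_gammaRegion hlam t s
  have hv : ∀ i, volume (A i) ≠ ⊤ := by
    intro i
    fin_cases i
    · exact v0 ▸ ENNReal.ofReal_ne_top
    · exact v1 ▸ ENNReal.ofReal_ne_top
    · exact v2 ▸ ENNReal.ofReal_ne_top
  have d01 : Disjoint (A 0) (A 1) := Set.disjoint_left.2 fun p h h' => h.2 h'.2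
  have d12 : Disjoint (A 1) (A 2) := Set.disjoint_left.2 fun p h h' => h'.2 h.1
  have d02 : Disjoint (A 0) (A 2) := Set.disjoint_left.2 fun p h h' => h.2 h'.1
  have hd : Pairwise fun i j => Disjoint (A i) (A j) := by
    intro i j hij
    fin_cases i <;> fin_cases j <;>
      first
      | exact absurd rfl hij
      | exact d01
      | exact d12
      | exact d02
      | exact d01.symm
      | exact d12.symm
      | exact d02.symm
  let Z : Fin 3 → Ω → ℝ := fun i ω => (G ω (A i)).toReal
  have hZ : ∀ i, Measurable (Z i) := fun i => (hG.measurable_apply (hA i)).ennreal_toReal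
  have hind : iIndepFun Z P := hG.iIndepFun_toReal hA hv hd
  have l := fun i => hG.map_toReal (hA i) (hv i)
  have l0 := l 0
  have l1 := l 1
  have l2 := l 2
  rw [v0, ENNReal.toReal_ofReal (by linarith)] at l0
  rw [v1, ENNReal.toReal_ofReal (Real.exp_pos _).le] at l1
  rw [v2, ENNReal.toReal_ofReal (by linarith)] at l2
  have i01 := (indepFun_iff_map_prod_eq_prod_map_map (hZ 0).aemeasurable (hZ 1).aemeasurable).1
    (hind.indepFun (i := 0) (j := 1) (by decide))
  have i012 := (indepFun_iff_map_prod_eq_prod_map_map (((hZ 0).prodMk (hZ 1)).aemeasurable)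
    (hZ 2).aemeasurable).1 (hind.indepFun_prodMk hZ 0 1 2 (by decide) (by decide))
  rw [i01] at i012
  have l0' : P.map (Z 0) = _ := l0
  have l1' : P.map (Z 1) = _ := l1
  have l2' : P.map (Z 2) = _ := l2
  rw [l0', l1', l2'] at i012
  rw [← i012, Measure.map_map (by fun_prop) (((hZ 0).prodMk (hZ 1)).prodMk (hZ 2))]
  refine Measure.map_congr ?_
  filter_upwards [hG.ae_ne_top (hA 0) (hv 0), hG.ae_ne_top (hA 1) (hv 1),
    hG.ae_ne_top (hA 2) (hv 2)] with ω h0 h1 h2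
  refine Prod.ext ?_ ?_
  · simp only [Function.comp, Z, randomMeasureProcess]
    rw [← ENNReal.toReal_add h0 h1, add_comm, ← measure_inter_add_sdiff (gammaRegion lam s) mt]
    rfl
  · simp only [Function.comp, Z, randomMeasureProcess]
    rw [← ENNReal.toReal_add h1 h2, ← measure_inter_add_sdiff (gammaRegion lam t) ms,
      Set.inter_comm (gammaRegion lam t)]
    rfl

theorem map_pair_eq_thinPair (hα : 0 < α) (hβ : 0 < β) (hlam : 0 < lam)
    (hG : IsGammaRandomMeasure α β G P) {s t : ℝ} (hst : s ≠ t) :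
    P.map (fun ω => (randomMeasureProcess G lam s ω, randomMeasureProcess G lam t ω)) =
      thinPair α β (Real.exp (-lam * |s - t|)) := by
  have h0 := Real.exp_pos (-lam * |s - t|)
  have h1 : Real.exp (-lam * |s - t|) < 1 :=
    Real.exp_lt_one_iff.2 (by nlinarith [abs_pos.2 (sub_ne_zero.2 hst)])
  rw [map_pair_randomMeasureProcess hlam hG, thinPair_eq_map_add hα hβ h0 h1,
    gammaLaw_of_pos (mul_pos hα (by linarith)), gammaLaw_of_pos (mul_pos hα h0)]

/-- The joint characteristic function at two times. -/
theorem integral_exp_pair (hα : 0 < α) (hβ : 0 < β) (hlam : 0 < lam)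
    (hG : IsGammaRandomMeasure α β G P) (s t a b : ℝ) :
    ∫ ω, Complex.exp (Complex.I * (a * randomMeasureProcess G lam s ω +
        b * randomMeasureProcess G lam t ω)) ∂P =
      (1 - Complex.I * a / β) ^ (-(α * (1 - Real.exp (-lam * |s - t|)) : ℝ) : ℂ) *
      (1 - Complex.I * (a + b) / β) ^ (-(α * Real.exp (-lam * |s - t|) : ℝ) : ℂ) *
      (1 - Complex.I * b / β) ^ (-(α * (1 - Real.exp (-lam * |s - t|)) : ℝ) : ℂ) := by
  have hle : Real.exp (-lam * |s - t|) ≤ 1 :=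
    Real.exp_le_one_iff.2 (by nlinarith [abs_nonneg (s - t)])
  have a1 : 0 ≤ α * (1 - Real.exp (-lam * |s - t|)) := mul_nonneg hα.le (by linarith)
  have a2 : 0 ≤ α * Real.exp (-lam * |s - t|) := by positivity
  have i1 := isProbabilityMeasure_gammaLaw a1 hβ
  have i2 := isProbabilityMeasure_gammaLaw a2 hβ
  have hmap : ∫ ω, Complex.exp (Complex.I * (a * randomMeasureProcess G lam s ω +
        b * randomMeasureProcess G lam t ω)) ∂P =
      ∫ p : ℝ × ℝ, Complex.exp (Complex.I * (a * p.1 + b * p.2)) ∂P.map (fun ω =>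
        (randomMeasureProcess G lam s ω, randomMeasureProcess G lam t ω)) := by
    rw [integral_map ((measurable_randomMeasureProcess hG s).prodMk
      (measurable_randomMeasureProcess hG t)).aemeasurable (by fun_prop)]
  rw [hmap, map_pair_randomMeasureProcess hlam hG, integral_map (by fun_prop) (by fun_prop)]
  have hsplit : ∀ p : (ℝ × ℝ) × ℝ, Complex.exp (Complex.I * (a * (p.1.1 + p.1.2 : ℝ) +
      b * (p.1.2 + p.2 : ℝ))) = (Complex.exp (a * p.1.1 * Complex.I) *
        Complex.exp ((a + b : ℝ) * p.1.2 * Complex.I)) * Complex.exp (b * p.2 * Complex.I) := by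
    intro p
    rw [← Complex.exp_add, ← Complex.exp_add]
    congr 1
    push_cast
    ring
  simp only [hsplit]
  rw [integral_prod_mul (fun p : ℝ × ℝ => Complex.exp (a * p.1 * Complex.I) *
      Complex.exp ((a + b : ℝ) * p.2 * Complex.I)) (fun x : ℝ => Complex.exp (b * x * Complex.I)),
    integral_prod_mul (fun x : ℝ => Complex.exp (a * x * Complex.I))
      (fun x : ℝ => Complex.exp ((a + b : ℝ) * x * Complex.I))]
  rw [← charFun_apply_real, ← charFun_apply_real, ← charFun_apply_real, charFun_gammaLaw a1 hβ,
    charFun_gammaLaw a1 hβ, charFun_gammaLaw a2 hβ]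
  push_cast
  rfl

omit [IsProbabilityMeasure P] in
theorem memLp_two_of_map_eq_gammaMeasure (hα : 0 < α) (hβ : 0 < β) {Z : Ω → ℝ}
    (hZ : Measurable Z) (h : P.map Z = gammaMeasure α β) : MemLp Z 2 P := by
  rw [memLp_two_iff_integrable_sq hZ.aestronglyMeasurable]
  have h1 := integrable_pow_gammaMeasure hβ 2 hα
  rw [← h] at h1
  exact (integrable_map_measure (by fun_prop) hZ.aemeasurable).1 h1

theorem variance_of_map_eq_gammaMeasure (hα : 0 < α) (hβ : 0 < β) {Z : Ω → ℝ}
    (hZ : Measurable Z) (h : P.map Z = gammaMeasure α β) :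
    ∫ ω, Z ω ∂P = α / β ∧ variance Z P = α / β ^ 2 := by
  have hm : ∀ n : ℕ, ∫ ω, Z ω ^ n ∂P = ∏ i ∈ Finset.range n, (α + i) / β := by
    intro n
    rw [← integral_pow_gammaMeasure hβ n hα, ← h, integral_map hZ.aemeasurable (by fun_prop)]
  have h1 := hm 1
  have h2 := hm 2
  simp [Finset.prod_range_succ] at h1 h2
  refine ⟨h1, ?_⟩
  rw [variance_eq_sub (memLp_two_of_map_eq_gammaMeasure hα hβ hZ h)]
  simp only [Pi.pow_apply, h1, h2]
  field_simp
  ring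

theorem correlation_randomMeasureProcess (hα : 0 < α) (hβ : 0 < β) (hlam : 0 < lam)
    (hG : IsGammaRandomMeasure α β G P) (s t : ℝ) :
    correlation (randomMeasureProcess G lam s) (randomMeasureProcess G lam t) P =
      Real.exp (-lam * |s - t|) := by
  have hm := measurable_randomMeasureProcess (lam := lam) hG
  have hl := map_randomMeasureProcess hα hlam hG
  obtain ⟨ms, vs⟩ := variance_of_map_eq_gammaMeasure hα hβ (hm s) (hl s)
  obtain ⟨mt, vt⟩ := variance_of_map_eq_gammaMeasure hα hβ (hm t) (hl t)
  have hpos : 0 < α / β ^ 2 := by positivity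
  rw [correlation, vs, vt, Real.mul_self_sqrt hpos.le]
  rcases eq_or_ne s t with rfl | hst
  · rw [covariance_self (hm s).aemeasurable, vs]
    simp [hpos.ne']
  · have h0 := Real.exp_pos (-lam * |s - t|)
    have h1 : Real.exp (-lam * |s - t|) < 1 :=
      Real.exp_lt_one_iff.2 (by nlinarith [abs_pos.2 (sub_ne_zero.2 hst)])
    have hmul := integral_mixed_thinPair hα hβ h0 h1 1 1
    rw [← map_pair_eq_thinPair hα hβ hlam hG hst, integral_map ((hm s).prodMk
      (hm t)).aemeasurable (by fun_prop)] at hmul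
    simp [Finset.sum_range_succ, Finset.prod_range_succ] at hmul
    rw [covariance_eq_sub (memLp_two_of_map_eq_gammaMeasure hα hβ (hm s) (hl s))
      (memLp_two_of_map_eq_gammaMeasure hα hβ (hm t) (hl t)), ms, mt]
    simp only [Pi.mul_apply, hmul, neg_mul]
    field_simp
    ring

end

theorem mainTheorem5 {Ω : Type*} [MeasurableSpace Ω] (P : Measure Ω)
    [IsProbabilityMeasure P] (α β lam : ℝ) (hα : 0 < α) (hβ : 0 < β) (hlam : 0 < lam)
    (G : Ω → Measure (ℝ × ℝ)) (hG : IsGammaRandomMeasure α β G P)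
    (X : ℝ → Ω → ℝ) (hX : X = randomMeasureProcess G lam) :
    -- strict stationarity, one-dimensional marginals, autocorrelation
    (∀ t, Measurable (X t)) ∧
    IsStationaryProcess X P ∧
    (∀ t, P.map (X t) = gammaMeasure α β) ∧
    (∀ t, MemLp (X t) 2 P) ∧
    (∀ s t, correlation (X s) (X t) P = Real.exp (-lam * |s - t|)) ∧
    -- joint characteristic function at any two times
    (∀ s t a b : ℝ,
      ∫ ω, Complex.exp (Complex.I * (a * X s ω + b * X t ω)) ∂P =
        (1 - Complex.I * a / β) ^ (-(α * (1 - Real.exp (-lam * |s - t|)) : ℝ) : ℂ) *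
        (1 - Complex.I * (a + b) / β) ^ (-(α * Real.exp (-lam * |s - t|) : ℝ) : ℂ) *
        (1 - Complex.I * b / β) ^ (-(α * (1 - Real.exp (-lam * |s - t|)) : ℝ) : ℂ)) ∧
    -- two-dimensional laws: those of consecutive values of the thinned process
    (∀ s t : ℝ, s ≠ t →
      ∀ (Ω' : Type*) [MeasurableSpace Ω'] (P' : Measure Ω') [IsProbabilityMeasure P']
        (Y : ℤ → Ω' → ℝ), IsThinnedGammaProcess α β (Real.exp (-lam * |s - t|)) Y P' →
        ∀ n : ℤ, P.map (fun ω => (X s ω, X t ω)) = P'.map (fun ω => (Y n ω, Y (n + 1) ω))) ∧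
    -- the laws of consecutive triplets differ from those of the thinned process
    (∀ s : ℝ,
      ∀ (Ω' : Type*) [MeasurableSpace Ω'] (P' : Measure Ω') [IsProbabilityMeasure P']
        (Y : ℤ → Ω' → ℝ), IsThinnedGammaProcess α β (Real.exp (-lam)) Y P' →
        ∀ n : ℤ, P.map (fun ω => (X s ω, X (s + 1) ω, X (s + 2) ω)) ≠
          P'.map (fun ω => (Y n ω, Y (n + 1) ω, Y (n + 2) ω))) ∧
    -- the process is not Markov, not even when observed at integer times only
    ¬ IsMarkovProcess X P ∧
    ¬ IsMarkovProcess (fun n : ℤ => X n) P ∧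
    -- infinitely divisible marginals of all orders
    (∀ (k : ℕ) (t : Fin k → ℝ),
      IsInfinitelyDivisibleLaw (P.map fun ω (i : Fin k) => X (t i) ω)) := by
  subst hX
  have hm := measurable_randomMeasureProcess (lam := lam) hG
  have hpair := fun (s t : ℝ) (hst : s ≠ t) => map_pair_eq_thinPair hα hβ hlam hG hst
  have hexp0 : ∀ u : ℝ, 0 < Real.exp (-lam * |u|) := fun u => Real.exp_pos _
  have hexp1 : ∀ s t : ℝ, s ≠ t → Real.exp (-lam * |s - t|) < 1 := fun s t hst =>
    Real.exp_lt_one_iff.2 (by nlinarith [abs_pos.2 (sub_ne_zero.2 hst)])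
  have h1 : Real.exp (-lam) < 1 := Real.exp_lt_one_iff.2 (by linarith)
  have hone : ∀ s : ℝ, P.map (fun ω => (randomMeasureProcess G lam s ω,
      randomMeasureProcess G lam (s + 1) ω)) = thinPair α β (Real.exp (-lam)) := by
    intro s
    simpa using hpair s (s + 1) (by simp)
  have htwo : ∀ s : ℝ, P.map (fun ω => (randomMeasureProcess G lam s ω,
      randomMeasureProcess G lam (s + 2) ω)) = thinPair α β (Real.exp (-lam) ^ 2) := by
    intro s
    have h := hpair s (s + 2) (by simp)
    rwa [show -lam * |s - (s + 2)| = (2 : ℕ) * -lam by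
      rw [sub_add_cancel_left, abs_neg, abs_two]; push_cast; ring, Real.exp_nat_mul] at h
  have e1 : (0 : ℝ) + 1 = 1 := zero_add 1
  have e2 : (1 : ℝ) + 1 = 2 := one_add_one_eq_two
  have e3 : (0 : ℝ) + 2 = 2 := zero_add 2
  refine ⟨hm, isStationaryProcess_randomMeasureProcess hlam hG,
    map_randomMeasureProcess hα hlam hG,
    fun t => memLp_two_of_map_eq_gammaMeasure hα hβ (hm t) (map_randomMeasureProcess hα hlam hG t),
    correlation_randomMeasureProcess hα hβ hlam hG, ?_, ?_, ?_, ?_, ?_,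
    fun k t => isInfinitelyDivisibleLaw_randomMeasureProcess hα hβ hlam hG t⟩
  · intro s t a b
    exact integral_exp_pair hα hβ hlam hG s t a b
  · intro s t hst Ω' _ P' _ Y hY n
    rw [hpair s t hst, hY.map_pair hα hβ (hexp0 _) (hexp1 s t hst)]
  · intro s Ω' _ P' _ Y hY n h
    have hYm := hY.measurable
    refine hY.map_skip_ne hα hβ (Real.exp_pos _) h1 n ?_
    have h2 := congrArg (fun μ => μ.map fun p : ℝ × ℝ × ℝ => (p.1, p.2.2)) h
    rw [Measure.map_map (by fun_prop) ((hm _).prodMk ((hm _).prodMk (hm _))),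
      Measure.map_map (by fun_prop) (by fun_prop)] at h2
    rw [← htwo s]
    exact h2.symm
  · refine not_isMarkovProcess_of_thinPair (t₀ := 0) (t₁ := 1) (t₂ := 2) hα hβ (Real.exp_pos _) h1
      hm (by norm_num) (by norm_num) ?_ ?_ ?_
    · simpa only [e1] using hone 0
    · simpa only [e2] using hone 1
    · simpa only [e3] using htwo 0
  · refine not_isMarkovProcess_of_thinPair (t₀ := 0) (t₁ := 1) (t₂ := 2) hα hβ (Real.exp_pos _) h1
      (fun n => hm n) (by norm_num) (by norm_num) ?_ ?_ ?_
    · simpa only [e1, Int.cast_zero, Int.cast_one] using hone 0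
    · simpa only [e2, Int.cast_one, Int.cast_ofNat] using hone 1
    · simpa only [e3, Int.cast_zero, Int.cast_ofNat] using htwo 0
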